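/- **Setting.** Let $N\ge 0$ be an integer, $T>0$, $\mathcal I=\{0,1\}^N$ the set of nodes, $\bar p=(1,\dots,1)$, and for $p\in\mathcal I$ let $\mathcal I_p$ be the set of strings obtained from $p$ by changing exactly one component, from $0$ to $1$. Let $\mathcal M=L^2([0,T],[0,1])^{\mathcal I}$. Costs $C(p,p',t,\tau,\rho)\in[0,\infty)$, for $p'\in\mathcal I_p$, $0\le t<\tau\le T$, $\rho\in\mathcal M$, and $\tilde C(p,t)\in\mathbb R$, for $t\in[0,T]$, are given. A control from $(p,t)$ consists of $r\ge 0$, times $t=t_0<t_1<\dots<t_r\le T$ and nodes $p=p_0,\dots,p_r$ with $p_{i+1}\in\mathcal I_{p_i}$, such that $p_r=\bar p$ or $t_r=T$; its cost is $\sum_{i=1}^r C(p_{i-1},p_i,t_{i-1},t_i,\rho)+\tilde C(p_r,t_r)$, and $V(p,t,\rho)$ is the infimum of the costs of all controls from $(p,t)$. For $p\ne\bar p$ and $t<T$ let $$P(p,t)=\operatorname*{arg\,min}_{p'\in\mathcal I_p,\ \tau\in(t,T]}\{V(p',\tau,\rho)+C(p,p',t,\tau,\rho)\}.$$ **Standing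 hypotheses.** (i) For every sufficiently small $h>0$ there are $B,L>0$ such that for all $p$, $p'\in\mathcal I_p$ and $\tau\in(0,T]$, the map $(t,\rho)\mapsto C(p,p',t,\tau,\rho)$ is bounded by $B$ and $L$-Lipschitz on $[0,\tau-h]\times\mathcal M$. (ii) $C$ is non-increasing in $\tau\in(t,T]$, and $C\to+\infty$ as $\tau\to t^+$, uniformly in $(p,p',t,\rho)$; moreover $\tau\mapsto C(p,p',t,\tau,\rho)$ is continuous on $(t,T)$. (iii) By convention $C(p,p,\cdot,\cdot,\cdot)=0$ and $C(\cdot,\cdot,T,T,\cdot)=0$; $\tilde C$ is bounded, and Lipschitz continuous in time. (iv) An agent in $p$ that decides at time $t$ to switch to $p'$ at time $\tau$ stays in $p$, and is counted in the mass of $p$, during $[t,\tau)$; its next decision is taken at time $\tau$. (v) Say that a switch from $p$ to $p'\in\mathcal I_p$ decided at time $t$ optimally generates $\tau$ if some control from $(p,t)$ with $r\ge1$, $p_1=p'$ and $t_1=\tau$ minimizes the cost among all controls from $(p,t)$ with $r\ge1$, $p_1=p'$. If, for the same $\rho,p,p'$, decision times $t_1<t_2$ optimally generate $\tau_1,\tau_2<T$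 respectively, then $\tau_1<\tau_2$. **The map $\psi_\varepsilon$.** Let $\rho^0=(\rho^0_j)_{j\in\mathcal I}$ be an initial distribution, $\rho^0_j\ge0$, $\sum_j\rho^0_j\le1$. Let $\varepsilon=T/m$ with an integer $m\ge1$. Let $C_\varepsilon$ be the set of all $\rho\in\mathcal M$ whose components are a.e. constant on each interval $(n\varepsilon,(n+1)\varepsilon)$, $0\le n<m$, with values in $[0,\sum_j\rho^0_j]$. For $\tau\in[0,T]$ let $F(\tau)$ be the set of the points of $\{0,\varepsilon,\dots,m\varepsilon\}$ nearest to $\tau$ (two points if $\tau$ is the midpoint of an interval). For $\rho\in C_\varepsilon$, an optimal path from $j$ is a sequence $(p_0,\tau_0)=(j,0),(p_1,\tau_1),\dots,(p_r,\tau_r)$ with $(p_{i+1},\tau_{i+1})\in P(p_i,\tau_i)$, ending as soon as $p_r=\bar p$ or $\tau_r=T$; an $\varepsilon$-optimal path from $j$ is a sequence obtained from such a path by replacing every $\tau_i$, $i\ge1$, by an element of $F(\tau_i)$. The extremal evolution $\rho^{\pi}$ of an $\varepsilon$-optimal path $\pi=((j,0),(p_1,\tilde\tau_1),\dots,(p_r,\tilde\tau_r))$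 is the mass evolution in which the whole mass $\rho^0_j$ follows $\pi$: it is in $p_i$ during $[\tilde\tau_i,\tilde\tau_{i+1})$ and in $p_r$ from $\tilde\tau_r$ on. A system of splitting coefficients assigns, for each $j$, to every initial segment $h$ of an $\varepsilon$-optimal path from $j$ non-negative coefficients with sum $1$: one for every pair $a=(p',\tilde\tau)$ such that $h$ followed by $a$ is again an initial segment of an $\varepsilon$-optimal path from $j$ (the fraction of the agents with history $h$ whose next switch is $a$), and, if $h$ itself is an $\varepsilon$-optimal path, one for ending the path at $h$. The weight $w(\pi)$ of an $\varepsilon$-optimal path is the product of the coefficients of the choices along it, including that of ending it. Then $\psi_\varepsilon(\rho)\subseteq C_\varepsilon$ is the set of all $\tilde\rho\in C_\varepsilon$ such that, for some system of splitting coefficients, $$\tilde\rho_k(t)=\sum_{j\in\mathcal I}\ \sum_{\pi\ \varepsilon\text{-optimal from }j} w(\pi)\,\rho^{\pi}_k(t)\qquad\text{for all }k\in\mathcal I\text{ and a.e. }t\in[0,T].$$ **Theorem.** Under these hypotheses, for every such $\rho^0$ and every $\varepsilon=T/m$, $m\ge1$, there exists an $\varepsilon$-mean-field equilibrium, that is,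 a $\rho_\varepsilon\in C_\varepsilon$ with $\rho_\varepsilon\in\psi_\varepsilon(\rho_\varepsilon)$. -/

import Mathlib

open MeasureTheory

noncomputable section

namespace SwitchingMFG

/-- The nodes of the network: the strings in `{0,1}^N` (`true` is 1, "visited"). -/
abbrev Node (N : ℕ) : Type := Fin N → Bool

/-- The final destination `(1,…,1)`. -/
def dest (N : ℕ) : Node N := fun _ => true

/-- The set `𝓘_p` of nodes reachable from `p` by one switch: exactly one component flips,
from 0 to 1. -/
def next {N : ℕ} (p : Node N) : Set (Node N) :=
  {q | ∃ i, p i = false ∧ q = Function.update p i true}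

/-- A `2^N`-tuple of functions in `L²([0,T])`, one for each node. -/
abbrev MassTuple (N : ℕ) (T : ℝ) : Type :=
  Node N → Lp ℝ 2 (volume.restrict (Set.Icc (0 : ℝ) T))

/-- `L²([0,T],[0,1])^{2^N}`. -/
def massSpace (N : ℕ) (T : ℝ) : Set (MassTuple N T) :=
  {ρ | ∀ p, ∀ᵐ t ∂(volume.restrict (Set.Icc (0 : ℝ) T)), 0 ≤ ρ p t ∧ ρ p t ≤ 1}

/-- The costs of the game: `C p p' t τ ρ` is the cost of the decision, taken at time `t` in the
node `p`, to switch to `p'` at time `τ`; only its values for `p' ∈ next p`, `0 ≤ t < τ ≤ T` and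
`ρ ∈ massSpace N T` matter. `Cfin p t` is the final cost. -/
structure Costs (N : ℕ) (T : ℝ) where
  C : Node N → Node N → ℝ → ℝ → MassTuple N T → ℝ
  Cfin : Node N → ℝ → ℝ

/-- A control `(r, σ, π)` of an agent which is in the node `p` at time `t`. A control that does
not end in the destination has to end at time `T`. In particular, `r = 0` if and only if
`p = (1,…,1)` or `t = T`. -/
structure Control (N : ℕ) (T : ℝ) (p : Node N) (t : ℝ) where
  r : ℕ
  σ : Fin (r + 1) → ℝ
  π : Fin (r + 1) → Node N
  σ_zero : σ 0 = t
  π_zero : π 0 = p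
  σ_strictMono : StrictMono σ
  σ_le : σ (Fin.last r) ≤ T
  π_step : ∀ i : Fin r, π i.succ ∈ next (π i.castSucc)
  σ_last : π (Fin.last r) ≠ dest N → σ (Fin.last r) = T

/-- The cost `J(p,t,(r,σ,π),ρ)`. If `p = (1,…,1)` or `t = T`, the sum is empty and the
cost is `Cfin p t`. -/
def J {N : ℕ} {T : ℝ} (G : Costs N T) (ρ : MassTuple N T) {p : Node N} {t : ℝ}
    (c : Control N T p t) : ℝ :=
  (∑ i : Fin c.r, G.C (c.π i.castSucc) (c.π i.succ) (c.σ i.castSucc) (c.σ i.succ) ρ)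
    + G.Cfin (c.π (Fin.last c.r)) (c.σ (Fin.last c.r))

/-- The value function `V(p,t,ρ)`. -/
def V {N : ℕ} {T : ℝ} (G : Costs N T) (ρ : MassTuple N T) (p : Node N) (t : ℝ) : ℝ :=
  ⨅ c : Control N T p t, J G ρ c

/-- The first switch of the control `c` exists, goes to `p'`, and is performed at the time `τ`. -/
def FirstSwitch {N : ℕ} {T : ℝ} {p : Node N} {t : ℝ} (c : Control N T p t) (p' : Node N)
    (τ : ℝ) : Prop :=
  ∃ h : 0 < c.r, c.π (Fin.succ ⟨0, h⟩) = p' ∧ c.σ (Fin.succ ⟨0, h⟩) = τ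

/-- The switch from `p` to `p'` with decision instant `t` optimally generates the switching
instant `τ`. -/
def OptimallyGenerates {N : ℕ} {T : ℝ} (G : Costs N T) (ρ : MassTuple N T) (p p' : Node N)
    (t τ : ℝ) : Prop :=
  ∃ c : Control N T p t, FirstSwitch c p' τ ∧
    ∀ (c' : Control N T p t) (τ' : ℝ), FirstSwitch c' p' τ' → J G ρ c ≤ J G ρ c'

/-- The standing hypotheses on the costs. -/
structure StandingHypotheses {N : ℕ} {T : ℝ} (G : Costs N T) : Prop where
  /-- The switching cost takes its values in `[0,∞)`. -/
  nonneg : ∀ p, ∀ p' ∈ next p, ∀ t τ, 0 ≤ t → t < τ → τ ≤ T → ∀ ρ ∈ massSpace N T,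
    0 ≤ G.C p p' t τ ρ
  /-- boundedness, away from the switching instant -/
  bounded : ∃ h₀ > 0, ∀ h, 0 < h → h < h₀ → ∃ B : ℝ,
    ∀ p, ∀ p' ∈ next p, ∀ τ, 0 < τ → τ ≤ T → ∀ t ∈ Set.Icc 0 (τ - h), ∀ ρ ∈ massSpace N T,
      |G.C p p' t τ ρ| ≤ B
  /-- Lipschitz continuity in the decision instant and the mass, away from the switching instant -/
  lipschitz : ∃ h₀ > 0, ∀ h, 0 < h → h < h₀ → ∃ L > 0,
    ∀ p, ∀ p' ∈ next p, ∀ τ, 0 < τ → τ ≤ T →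
      ∀ t' ∈ Set.Icc 0 (τ - h), ∀ t'' ∈ Set.Icc 0 (τ - h),
      ∀ ρ' ∈ massSpace N T, ∀ ρ'' ∈ massSpace N T,
        |G.C p p' t' τ ρ' - G.C p p' t'' τ ρ''| ≤ L * (|t' - t''| + ‖ρ' - ρ''‖)
  /-- monotonicity in the switching instant -/
  antitone : ∀ p, ∀ p' ∈ next p, ∀ t ∈ Set.Icc 0 T, ∀ ρ ∈ massSpace N T,
    AntitoneOn (fun τ => G.C p p' t τ ρ) (Set.Ioc t T)
  /-- the cost tends to `+∞` as `τ → t⁺`, uniformly in all the other variables -/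
  blowup : ∀ M : ℝ, ∃ δ > 0, ∀ p, ∀ p' ∈ next p, ∀ t ∈ Set.Icc 0 T, ∀ τ ∈ Set.Ioc t T,
    τ < t + δ → ∀ ρ ∈ massSpace N T, M ≤ G.C p p' t τ ρ
  /-- continuity of the switching cost in the switching instant -/
  continuous_switch : ∀ p, ∀ p' ∈ next p, ∀ t ∈ Set.Icc 0 T, ∀ ρ ∈ massSpace N T,
    ContinuousOn (fun τ => G.C p p' t τ ρ) (Set.Ioo t T)
  /-- convention outside the domain of the switching cost -/
  self_zero : ∀ p t τ ρ, G.C p p t τ ρ = 0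
  /-- convention outside the domain of the switching cost -/
  final_zero : ∀ p p' ρ, G.C p p' T T ρ = 0
  /-- The final cost is bounded. -/
  fin_bounded : ∃ B : ℝ, ∀ p, ∀ t ∈ Set.Icc 0 T, |G.Cfin p t| ≤ B
  /-- The final cost is Lipschitz continuous in time. -/
  fin_lipschitz : ∃ K : NNReal, ∀ p, LipschitzOnWith K (G.Cfin p) (Set.Icc 0 T)
  /-- For a given switch, later decisions optimally generate later switching instants. -/
  increasing : ∀ ρ ∈ massSpace N T, ∀ p, ∀ p' ∈ next p, ∀ t₁ t₂ τ₁ τ₂ : ℝ,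
    0 ≤ t₁ → t₁ < t₂ → τ₁ < T → τ₂ < T →
    OptimallyGenerates G ρ p p' t₁ τ₁ → OptimallyGenerates G ρ p p' t₂ τ₂ → τ₁ < τ₂

/-- `P(p,t)`: the pairs `(p',τ)`, with `p' ∈ next p` and `τ ∈ (t,T]`, which minimize
`V(p',τ) + C(p,p',t,τ)`. -/
def optimalSwitches {N : ℕ} {T : ℝ} (G : Costs N T) (ρ : MassTuple N T) (p : Node N) (t : ℝ) :
    Set (Node N × ℝ) :=
  {a | (a.1 ∈ next p ∧ a.2 ∈ Set.Ioc t T) ∧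
    ∀ b : Node N × ℝ, b.1 ∈ next p → b.2 ∈ Set.Ioc t T →
      V G ρ a.1 a.2 + G.C p a.1 t a.2 ρ ≤ V G ρ b.1 b.2 + G.C p b.1 t b.2 ρ}

/-- Optimal paths from `(p,t)`: the list of the successive pairs (new node, switching instant),
each one optimal for the preceding pair, until the destination or the time `T` is reached. -/
def IsOptimalPath {N : ℕ} {T : ℝ} (G : Costs N T) (ρ : MassTuple N T) :
    Node N → ℝ → List (Node N × ℝ) → Prop
  | p, t, [] => p = dest N ∨ t = T
  | p, t, a :: l => a ∈ optimalSwitches G ρ p t ∧ IsOptimalPath G ρ a.1 a.2 l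

/-- `F(τ)`, for the partition of `[0,T]` with nodes `n ε`, `0 ≤ n ≤ m`, `ε = T/m` (a node `n ε` is
represented by `n`): `⌊τ/ε⌋` if `τ` is at most the middle point of its interval of the partition,
`⌈τ/ε⌉` if it is at least the middle point, both of them at the middle point. -/
def rounding (T : ℝ) (m : ℕ) (τ : ℝ) : Set (Fin (m + 1)) :=
  {n | ((n : ℕ) = ⌊τ / (T / m)⌋₊ ∧ τ ≤ ⌊τ / (T / m)⌋₊ * (T / m) + (T / m) / 2) ∨
       ((n : ℕ) = ⌈τ / (T / m)⌉₊ ∧ ⌊τ / (T / m)⌋₊ * (T / m) + (T / m) / 2 ≤ τ)}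

/-- The `ε`-optimal paths (`ε = T/m`) of the agents that are in `j` at time `0`: an optimal path,
with each switching instant `τ` replaced by an element of `F(τ)`. The initial pair `(j,0)` is not
listed. -/
def epsPaths {N : ℕ} {T : ℝ} (G : Costs N T) (m : ℕ) (ρ : MassTuple N T) (j : Node N) :
    Set (List (Node N × Fin (m + 1))) :=
  {l | ∃ l₀ : List (Node N × ℝ), IsOptimalPath G ρ j 0 l₀ ∧
    List.Forall₂ (fun a b => b.1 = a.1 ∧ b.2 ∈ rounding T m a.2) l₀ l}

/-- The number of zeros of a string. -/
def zeros {N : ℕ} (p : Node N) : ℕ := (Finset.univ.filter fun i => p i = false).card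

lemma zeros_lt {N : ℕ} {p q : Node N} (h : q ∈ next p) : zeros q < zeros p := by
  obtain ⟨i, hi, rfl⟩ := h
  apply Finset.card_lt_card
  refine ⟨fun k hk => ?_, fun hsub => ?_⟩
  · by_cases hki : k = i <;> simp_all [Function.update]
  · have := hsub (show i ∈ Finset.univ.filter fun i => p i = false by simpa using hi)
    simp at this

lemma IsOptimalPath.length_le {N : ℕ} {T : ℝ} {G : Costs N T} {ρ : MassTuple N T} :
    ∀ {l : List (Node N × ℝ)} {p : Node N} {t : ℝ}, IsOptimalPath G ρ p t l →
      l.length ≤ zeros p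
  | [], _, _, _ => Nat.zero_le _
  | _ :: _, _, _, h =>
    (Nat.succ_le_succ (IsOptimalPath.length_le h.2)).trans (zeros_lt h.1.1.1)

/-- There are finitely many `ε`-optimal paths. -/
lemma epsPaths_finite {N : ℕ} {T : ℝ} (G : Costs N T) (m : ℕ) (ρ : MassTuple N T)
    (j : Node N) : (epsPaths G m ρ j).Finite := by
  refine (List.finite_length_le (Node N × Fin (m + 1)) (zeros j)).subset ?_
  rintro l ⟨l₀, h, h2⟩
  exact h2.length_eq.symm.trans_le h.length_le

/-- The node in which, at time `t`, one finds an agent that starts in `p` and follows the path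
`l` (with the times of the partition of step `T/m`): the agent stays in a node, and is counted
there, until the instant of its next switch. -/
def location {N : ℕ} (T : ℝ) (m : ℕ) : Node N → List (Node N × Fin (m + 1)) → ℝ → Node N
  | p, [], _ => p
  | p, a :: l, t => if t < ((a.2 : ℕ) : ℝ) * (T / m) then p else location T m a.1 l t

/-- The extremal evolution generated by the path `l`: the mass in the node `k` at time `t`, if
the whole mass `μ` which is in `j` at time `0` follows `l`. -/
def extremalEvolution {N : ℕ} (T : ℝ) (m : ℕ) (μ : ℝ) (j : Node N)
    (l : List (Node N × Fin (m + 1))) (k : Node N) (t : ℝ) : ℝ :=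
  if location T m j l t = k then μ else 0

/-- Coefficients of the splittings of the agents that start in `j`, at every decision
along the `ε`-optimal paths. Here `h` is the list of the switches already performed, and
`lam h (some a)` is the fraction, among the agents with history `h`, of those who choose the pair
`a = (node, switching instant)` as next switch; `lam h none` is the fraction of those whose path
is finished. Only choices along `ε`-optimal paths are allowed, and at every decision the
coefficients have sum 1. -/
structure IsSplitting {N : ℕ} {T : ℝ} (G : Costs N T) (m : ℕ) (ρ : MassTuple N T) (j : Node N)
    (lam : List (Node N × Fin (m + 1)) → Option (Node N × Fin (m + 1)) → ℝ) : Prop where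
  mem_Icc : ∀ h a, lam h a ∈ Set.Icc (0 : ℝ) 1
  none_eq_zero : ∀ h, h ∉ epsPaths G m ρ j → lam h none = 0
  some_eq_zero : ∀ h a, (¬ ∃ l ∈ epsPaths G m ρ j, (h ++ [a]) <+: l) → lam h (some a) = 0
  sum_eq_one : ∀ h, (∃ l ∈ epsPaths G m ρ j, h <+: l) → ∑ a, lam h a = 1

/-- The product of the coefficients along the path `l`, after the history `h`. -/
def pathWeight {A : Type} (lam : List A → Option A → ℝ) : List A → List A → ℝ
  | h, [] => lam h none
  | h, a :: l => lam h (some a) * pathWeight lam (h ++ [a]) l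

/-- The space `C_ε`, `ε = T/m`: the tuples of functions that are constant on every open interval
of the partition, with values between `0` and the total mass of the initial distribution `ρ₀`. -/
def Ceps {N : ℕ} (T : ℝ) (m : ℕ) (ρ₀ : Node N → ℝ) : Set (MassTuple N T) :=
  {ρ | ∀ p,
    (∀ i < m, ∃ c : ℝ, ∀ᵐ t ∂(volume.restrict (Set.Icc (0 : ℝ) T)),
      t ∈ Set.Ioo ((i : ℝ) * (T / m)) (((i : ℝ) + 1) * (T / m)) → ρ p t = c) ∧
    ∀ᵐ t ∂(volume.restrict (Set.Icc (0 : ℝ) T)), 0 ≤ ρ p t ∧ ρ p t ≤ ∑ j, ρ₀ j}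

/-- The set-valued map `ψ_ε`, `ε = T/m`: `ψ_ε(ρ)` is the set of the elements of `C_ε` that are
convexifications, decision by decision, of the extremal evolutions along the paths that are
`ε`-optimal for `ρ`. -/
def psi {N : ℕ} {T : ℝ} (G : Costs N T) (m : ℕ) (ρ₀ : Node N → ℝ) (ρ : MassTuple N T) :
    Set (MassTuple N T) :=
  {ρ' | ρ' ∈ Ceps T m ρ₀ ∧
    ∃ lam : Node N → List (Node N × Fin (m + 1)) → Option (Node N × Fin (m + 1)) → ℝ,
      (∀ j, IsSplitting G m ρ j (lam j)) ∧
      ∀ k, ∀ᵐ t ∂(volume.restrict (Set.Icc (0 : ℝ) T)),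
        ρ' k t = ∑ j, ∑ l ∈ (epsPaths_finite G m ρ j).toFinset,
          pathWeight (lam j) [] l * extremalEvolution T m (ρ₀ j) j l k t}

/-- An `ε`-mean-field equilibrium, `ε = T/m`: a fixed point of `ψ_ε` in `C_ε`. -/
def IsEpsEquilibrium {N : ℕ} {T : ℝ} (G : Costs N T) (m : ℕ) (ρ₀ : Node N → ℝ)
    (ρ : MassTuple N T) : Prop :=
  ρ ∈ Ceps T m ρ₀ ∧ ρ ∈ psi G m ρ₀ ρ

end SwitchingMFG

end

/-! A profile assigns to every starting node a list of switches at times of the partition. Paths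
with more than `N` switches never occur, so finitely many profiles suffice. A point `x` of the
simplex over the profiles defines a distribution, `mixture`, in which the profile `i` is followed
with weight `x i`. It is an equilibrium as soon as every profile of positive weight consists of
paths that are `ε`-optimal for this very mixture.

Such an `x` comes from `Scarf.exists_mem_of_cover`, which plays the role of Kakutani's theorem. Let
`A i` be the set of weights whose mixture makes all the paths of the profile `i` optimal. The sets
`A i` cover the simplex because optimal paths exist (`epsPaths_nonempty`). They are closed because
the rounded optimal paths have a closed graph (`mem_epsPaths_of_tendsto`). Both facts rest on
`exists_limit_control`: the blow-up of the switching cost keeps switches apart, their number is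
bounded, and the cost is lower semicontinuous. The covering theorem itself follows from Scarf's
lemma on finer and finer grids of the simplex.

Finally, mixing profiles agrees with splitting decision by decision, because every probability on a
finite set of paths is a product of conditional probabilities (`exists_splitting`). -/

namespace Scarf

/-! ### Dominant sets and the replacement of one element. -/

open Finset

variable {I W : Type*}

/-- No element is strictly above all the minima of `S`, one for each of the rankings `r i`. -/
def Dominant (r : I → W → ℕ) (S : Finset W) : Prop :=
  ∀ y, ∃ i, ∀ x ∈ S, r i y ≤ r i x

/-- `y` is above the minimum of `S` for all the rankings, except possibly `r i`. -/
def Above (r : I → W → ℕ) (S : Finset W) (i : I) (y : W) : Prop :=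
  ∀ k, k ≠ i → ∃ x ∈ S, r k x < r k y

/-- `y` is the greatest element, for `r i`, among those that are `Above`. -/
def IsTop (r : I → W → ℕ) (S : Finset W) (i : I) (y : W) : Prop :=
  Above r S i y ∧ ∀ z, Above r S i z → r i z ≤ r i y

variable {r : I → W → ℕ} {S : Finset W}

lemma Dominant.mono {S' : Finset W} (h : Dominant r S) (hs : S' ⊆ S) : Dominant r S' :=
  fun y => (h y).imp fun _ hi x hx => hi x (hs hx)

lemma Dominant.le_of_above (h : Dominant r S) {i : I} {y : W} (hy : Above r S i y) :
    ∀ x ∈ S, r i y ≤ r i x := by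
  obtain ⟨l, hl⟩ := h y
  by_cases hli : l = i
  · exact hli ▸ hl
  · obtain ⟨x, hx, hlt⟩ := hy l hli
    exact absurd (hl x hx) (not_le.2 hlt)

lemma Dominant.not_above_both (h : Dominant r S) {i j : I} (hij : i ≠ j) {y : W}
    (hi : Above r S i y) (hj : Above r S j y) : False := by
  obtain ⟨x, hx, hlt⟩ := hj i hij
  exact absurd (h.le_of_above hi x hx) (not_le.2 hlt)

lemma exists_isTop [Finite W] {i : I} {y : W} (h : Above r S i y) : ∃ z, IsTop r S i z := by
  obtain ⟨z, hz, hmax⟩ := Set.exists_max_image {z | Above r S i z} (r i) (Set.toFinite _) ⟨y, h⟩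
  exact ⟨z, hz, hmax⟩

lemma IsTop.unique (hr : ∀ i, Function.Injective (r i)) {i : I} {y z : W} (hy : IsTop r S i y)
    (hz : IsTop r S i z) : y = z :=
  hr i (le_antisymm (hz.2 y hy.1) (hy.2 z hz.1))

variable [DecidableEq W]

/-- A point `z` that is `Above` for `i` is blocked by the ranking `i`, where `y` is the highest of
its kind. Any other `z` is blocked by some `k ≠ i`, and `y` does not interfere, being above the
minimum of `S` for `k`. -/
lemma IsTop.dominant_insert (h : Dominant r S) {i : I} {y : W} (hy : IsTop r S i y) :
    Dominant r (insert y S) := by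
  intro z
  by_cases hz : Above r S i z
  · refine ⟨i, fun x hx => ?_⟩
    rcases mem_insert.1 hx with rfl | hx
    · exact hy.2 z hz
    · exact h.le_of_above hz x hx
  · unfold Above at hz
    push Not at hz
    obtain ⟨k, hk, hle⟩ := hz
    refine ⟨k, fun x hx => ?_⟩
    rcases mem_insert.1 hx with rfl | hx
    · obtain ⟨w, hw, hlt⟩ := hy.1 k hk
      exact (hle w hw).trans hlt.le
    · exact hle x hx

variable [Fintype I] [DecidableEq I]

/-- For a dominant set `S` with one element less than the number of rankings, exactly two rankings
have the same minimum on `S`, and the dominant sets `insert y S` come from these two. -/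
lemma exists_pair (hr : ∀ i, Function.Injective (r i)) (h : Dominant r S)
    (hcard : S.card + 1 = Fintype.card I) (hS : S.Nonempty) :
    ∃ i j, i ≠ j ∧ (∃ x₀ ∈ S, ∀ x ∈ S, r i x₀ ≤ r i x ∧ r j x₀ ≤ r j x) ∧
      (∀ y, Above r S i y ∨ Above r S j y → y ∉ S) ∧
      ∀ y, y ∉ S → (Dominant r (insert y S) ↔ IsTop r S i y ∨ IsTop r S j y) := by
  choose f hfS hf using fun k => S.exists_min_image (r k) hS
  have key : ∀ k x, x ∈ S → (∀ x' ∈ S, r k x ≤ r k x') → f k = x := fun k x hx hle =>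
    hr k (le_antisymm (hf k x hx) (hle _ (hfS k)))
  -- Dominance tested on `S` itself: every element is the minimum for some ranking. With one ranking
  -- more than elements, exactly two rankings share a minimum.
  have hsurj : ∀ x ∈ S, ∃ k, f k = x := fun x hx =>
    (h x).imp fun k hk => key k x hx hk
  have hinj : ∀ k, (∀ x ∈ S, ∃ l, l ≠ k ∧ f l = x) → Set.InjOn f (univ.erase k : Finset I) := by
    intro k hk
    apply injOn_of_card_image_eq
    have : (univ.erase k).image f = S := by
      ext x
      simp only [mem_image, mem_erase, mem_univ, and_true]
      exact ⟨fun ⟨l, _, hl⟩ => hl ▸ hfS l, hk x⟩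
    rw [this, card_erase_of_mem (mem_univ k), card_univ]
    omega
  obtain ⟨i, j, hij, hfij⟩ : ∃ i j, i ≠ j ∧ f i = f j := by
    by_contra! hne
    have hi : Function.Injective f := fun a b hab => by_contra fun hn => hne a b hn hab
    have := card_le_card_of_injOn f (s := univ) (t := S) (fun k _ => hfS k) hi.injOn
    rw [card_univ] at this
    omega
  have hsi : ∀ k ∈ ({i, j} : Set I), ∀ x ∈ S, ∃ l, l ≠ k ∧ f l = x := by
    rintro k (rfl | rfl) x hx <;> obtain ⟨l, hl⟩ := hsurj x hx
    · by_cases hlk : l = k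
      · exact ⟨j, hij.symm, by rw [← hfij, ← hlk, hl]⟩
      · exact ⟨l, hlk, hl⟩
    · by_cases hlk : l = k
      · exact ⟨i, hij, by rw [hfij, ← hlk, hl]⟩
      · exact ⟨l, hlk, hl⟩
  have hnot : ∀ k ∈ ({i, j} : Set I), ∀ y, Above r S k y → y ∉ S := by
    intro k hk y hy hyS
    obtain ⟨l, hlk, hl⟩ := hsi k hk y hyS
    obtain ⟨x, hx, hlt⟩ := hy l hlk
    have := hf l x hx
    rw [hl] at this
    omega
  refine ⟨i, j, hij, ⟨f i, hfS i, fun x hx => ⟨hf i x hx, hfij ▸ hf j x hx⟩⟩, ?_, ?_⟩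
  · rintro y (hy | hy)
    · exact hnot i (by simp) y hy
    · exact hnot j (by simp) y hy
  intro y hyS
  constructor
  · intro hd
    obtain ⟨k, hk⟩ := hd y
    -- As `y` is the minimum of the enlarged set for `k`, every element of `S` must remain the
    -- minimum for another ranking.
    have hk' : ∀ x ∈ S, ∃ l, l ≠ k ∧ f l = x ∧ r l x ≤ r l y := by
      intro x hx
      obtain ⟨l, hl⟩ := hd x
      refine ⟨l, ?_, key l x hx fun x' hx' => hl x' (mem_insert_of_mem hx'),
        hl y (mem_insert_self _ _)⟩
      rintro rfl
      have h1 := hk x (mem_insert_of_mem hx)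
      have h2 := hl y (mem_insert_self _ _)
      exact hyS (hr l (le_antisymm h1 h2) ▸ hx)
    have hinjk := hinj k fun x hx => (hk' x hx).imp fun l hl => ⟨hl.1, hl.2.1⟩
    have htop : IsTop r S k y := by
      refine ⟨fun l hl => ?_, fun z hz => ?_⟩
      · obtain ⟨l', hl'k, hl', hle⟩ := hk' (f l) (hfS l)
        have : l' = l := hinjk (by simpa using hl'k) (by simpa using hl) hl'
        subst this
        refine ⟨_, hfS l', lt_of_le_of_ne hle fun he => hyS ?_⟩
        rw [← hr l' he]
        exact hfS l'
      · exact hd.le_of_above (fun l hl => (hz l hl).imp fun x hx =>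
          ⟨mem_insert_of_mem hx.1, hx.2⟩) y (mem_insert_self _ _)
    -- Otherwise `i` and `j` would both lie where `f` is injective.
    have : k = i ∨ k = j := by
      by_contra! hne
      exact hij (hinjk (by simpa using hne.1.symm) (by simpa using hne.2.symm) hfij)
    rcases this with rfl | rfl
    · exact Or.inl htop
    · exact Or.inr htop
  · rintro (hy | hy)
    · exact hy.dominant_insert h
    · exact hy.dominant_insert h

/-- In a set with as many elements as there are colours, and not all the colours, the number of
elements whose removal leaves exactly the colours different from `i₀` is even. -/
lemma even_card_removable (c : W → I) (i₀ : I) {R : Finset W}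
    (hcard : R.card = Fintype.card I) (hR : R.image c ≠ univ) :
    Even (R.filter fun x => (R.erase x).image c = univ.erase i₀).card := by
  rcases (R.filter fun x => (R.erase x).image c = univ.erase i₀).eq_empty_or_nonempty with h | h
  · simp [h]
  obtain ⟨x, hx⟩ := h
  obtain ⟨hxR, hx⟩ := mem_filter.1 hx
  have himg : ∀ y ∈ R, c y ≠ i₀ := by
    have hsub : ∀ y ∈ R.erase x, c y ≠ i₀ := fun y hy => by
      have := mem_image_of_mem c hy
      rw [hx] at this
      exact (mem_erase.1 this).1
    intro y hy
    by_cases hyx : y = x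
    · subst hyx
      intro hc
      apply hR
      rw [← insert_erase hxR, image_insert, hx, hc, insert_erase (mem_univ _)]
    · exact hsub y (mem_erase.2 ⟨hyx, hy⟩)
  have hinj : Set.InjOn c (R.erase x) := by
    apply injOn_of_card_image_eq
    rw [hx, card_erase_of_mem (mem_univ _), card_erase_of_mem hxR, hcard, card_univ]
  -- The colours on `R.erase x` are all distinct and exhaust those different from `i₀`, so `x`
  -- shares its colour with exactly one `x'`. Only these two can be removed.
  obtain ⟨x', hx', hcx⟩ : ∃ x' ∈ R.erase x, c x' = c x := by
    rw [← mem_image, hx]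
    simpa using himg x hxR
  obtain ⟨hne, hx'R⟩ := mem_erase.1 hx'
  have : (R.filter fun x => (R.erase x).image c = univ.erase i₀) = {x, x'} := by
    ext y
    simp only [mem_filter, mem_insert, mem_singleton]
    constructor
    · rintro ⟨hyR, hy⟩
      by_contra! hn
      have hcy : c y ∈ (R.erase y).image c := by
        rw [hy]
        simpa using himg y hyR
      obtain ⟨z, hz, hcz⟩ := mem_image.1 hcy
      obtain ⟨hzy, hzR⟩ := mem_erase.1 hz
      by_cases hzx : z = x
      · subst hzx
        exact hn.2 (hinj (by simp [hn.1, hyR]) hx' (by rw [← hcz, hcx]))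
      · exact hzy (hinj (by simp [hzx, hzR]) (by simp [hn.1, hyR]) hcz)
    · rintro (rfl | rfl)
      · exact ⟨hxR, hx⟩
      · refine ⟨hx'R, ?_⟩
        rw [← hx]
        ext k
        simp only [mem_image, mem_erase]
        constructor
        · rintro ⟨z, ⟨hz, hzR⟩, rfl⟩
          by_cases hzx : z = x
          · exact ⟨y, ⟨hne, hx'R⟩, by rw [hcx, hzx]⟩
          · exact ⟨z, ⟨hzx, hzR⟩, rfl⟩
        · rintro ⟨z, ⟨hz, hzR⟩, rfl⟩
          by_cases hzx : z = y
          · exact ⟨x, ⟨hne.symm, hxR⟩, by rw [hzx, hcx]⟩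
          · exact ⟨z, ⟨hzx, hzR⟩, rfl⟩
  rw [this, card_pair hne.symm]
  exact even_two

end Scarf

/-! ### Slack points, the parity argument and Scarf's lemma. -/

namespace Scarf

open Finset

variable {I V : Type*}

/-- The rankings of the points `V`, extended to the slack points `I`: the slack point `i` is the
lowest for the ranking `i`, and above all the points of `V` for the others. -/
structure IsSlack (r : I → V ⊕ I → ℕ) : Prop where
  inj : ∀ i, Function.Injective (r i)
  bot : ∀ i w, w ≠ Sum.inr i → r i (Sum.inr i) < r i w
  top : ∀ i j v, i ≠ j → r i (Sum.inl v) < r i (Sum.inr j)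

variable {r : I → V ⊕ I → ℕ} {S : Finset (V ⊕ I)}

lemma IsSlack.above_slack (hr : IsSlack r) {v : V} (hv : Sum.inl v ∈ S) (i : I) :
    Above r S i (Sum.inr i) :=
  fun k hk => ⟨_, hv, hr.top k i v hk⟩

variable [Fintype I] [DecidableEq I] [DecidableEq V]

/-- For the ranking `i`, a point of `V` is below every slack point other than `i`; a slack point is
the lowest for its own ranking. -/
lemma IsSlack.dominant_boundary (hr : IsSlack r) (i : I) :
    Dominant r ((univ.erase i).map Function.Embedding.inr : Finset (V ⊕ I)) := by
  rintro (v | k)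
  · refine ⟨i, fun x hx => ?_⟩
    obtain ⟨j, hj, rfl⟩ := mem_map.1 hx
    exact (hr.top i j v (mem_erase.1 hj).1.symm).le
  · refine ⟨k, fun x _ => ?_⟩
    by_cases h : x = Sum.inr k
    · rw [h]
    · exact (hr.bot k x h).le

variable [Fintype V]

open Classical in
/-- A dominant set with one element less than the number of rankings can be enlarged in exactly
two ways if it contains a point of `V`. -/
lemma IsSlack.card_extensions_of_mem (hr : IsSlack r) (h : Dominant r S)
    (hcard : S.card + 1 = Fintype.card I) {v : V} (hv : Sum.inl v ∈ S) :
    (univ.filter fun y => y ∉ S ∧ Dominant r (insert y S)).card = 2 := by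
  obtain ⟨i, j, hij, -, hnot, hiff⟩ := exists_pair hr.inj h hcard ⟨_, hv⟩
  obtain ⟨y, hy⟩ := exists_isTop (hr.above_slack hv i)
  obtain ⟨z, hz⟩ := exists_isTop (hr.above_slack hv j)
  rw [card_eq_two]
  refine ⟨y, z, ?_, ?_⟩
  · rintro rfl
    exact h.not_above_both hij hy.1 hz.1
  · ext w
    simp only [mem_filter, mem_univ, true_and, mem_insert, mem_singleton]
    constructor
    · rintro ⟨hw, hd⟩
      exact ((hiff w hw).1 hd).imp (fun h' => h'.unique hr.inj hy) fun h' => h'.unique hr.inj hz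
    · rintro (rfl | rfl)
      · have := hnot w (Or.inl hy.1)
        exact ⟨this, (hiff w this).2 (Or.inl hy)⟩
      · have := hnot w (Or.inr hz.1)
        exact ⟨this, (hiff w this).2 (Or.inr hz)⟩

open Classical in
/-- A set of all the slack points but one can be enlarged to a dominant set in exactly one way. -/
lemma IsSlack.card_extensions_boundary [Nonempty V] (hr : IsSlack r) (hI : 1 < Fintype.card I)
    (i₀ : I) (hS : S = (univ.erase i₀).map Function.Embedding.inr) :
    (univ.filter fun y => y ∉ S ∧ Dominant r (insert y S)).card = 1 := by
  have hd : Dominant r S := hS ▸ hr.dominant_boundary i₀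
  have hcard : S.card + 1 = Fintype.card I := by
    rw [hS, card_map, card_erase_of_mem (mem_univ _), card_univ]
    omega
  have hmem : ∀ k, Sum.inr k ∈ S ↔ k ≠ i₀ := by simp [hS]
  have hinl : ∀ v, Sum.inl v ∉ S := by simp [hS]
  obtain ⟨i, j, hij, ⟨x₀, hx₀, hmin⟩, hnot, hiff⟩ := exists_pair hr.inj hd hcard
    (card_pos.1 (by omega))
  have hmin' : ∀ k ≠ i₀, (∀ x ∈ S, r k x₀ ≤ r k x) → x₀ = Sum.inr k := by
    intro k hk hle
    by_contra hne
    exact absurd (hle _ ((hmem k).2 hk)) (not_le.2 (hr.bot k x₀ hne))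
  -- Outside `S` there are only the points of `V` and `inr i₀`, all below `S` for the ranking `i₀`.
  -- So a ranking other than `i₀` yields no extension.
  have hempty : ∀ k ≠ i₀, ∀ y, y ∉ S → ¬ Above r S k y := by
    intro k hk y hy ha
    obtain ⟨x, hx, hlt⟩ := ha i₀ hk.symm
    rcases x with v | l
    · exact hinl v hx
    rcases y with v | l'
    · exact absurd (hr.top i₀ l v ((hmem l).1 hx).symm) (not_lt.2 hlt.le)
    · have : l' = i₀ := by simpa [hmem] using hy
      subst this
      exact absurd (hr.bot l' (Sum.inr l) (by simpa using (hmem l).1 hx)) (not_lt.2 hlt.le)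
  obtain ⟨v⟩ := ‹Nonempty V›
  have habove : Above r S i₀ (Sum.inl v) := fun k hk =>
    ⟨Sum.inr k, (hmem k).2 hk, hr.bot k _ (by simp)⟩
  -- For `k ≠ i₀` the minimum of `S` is `inr k`, hence two rankings with a common minimum cannot
  -- both differ from `i₀`.
  have hor : i = i₀ ∨ j = i₀ := by
    by_contra! hne
    have h1 := hmin' i hne.1 fun x hx => (hmin x hx).1
    have h2 := hmin' j hne.2 fun x hx => (hmin x hx).2
    exact hij (Sum.inr_injective (h1.symm.trans h2))
  obtain ⟨y, hy⟩ := exists_isTop habove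
  rw [card_eq_one]
  refine ⟨y, ?_⟩
  ext w
  simp only [mem_filter, mem_univ, true_and, mem_singleton]
  constructor
  · rintro ⟨hw, hdw⟩
    have key : ∀ k, IsTop r S k w → w = y := fun k hk => by
      by_cases hk0 : k = i₀
      · subst hk0
        exact hk.unique hr.inj hy
      · exact absurd hk.1 (hempty k hk0 w hw)
    rcases (hiff w hw).1 hdw with h' | h' <;> exact key _ h'
  · rintro rfl
    rcases hor with rfl | rfl
    · have := hnot w (Or.inl hy.1)
      exact ⟨this, (hiff w this).2 (Or.inl hy)⟩
    · have := hnot w (Or.inr hy.1)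
      exact ⟨this, (hiff w this).2 (Or.inr hy)⟩

/-- The parity argument: some dominant set contains all the colours. -/
lemma IsSlack.exists_dominant_rainbow [Nonempty V] (hr : IsSlack r) (hI : 1 < Fintype.card I)
    (c : V ⊕ I → I) (hc : ∀ i, c (Sum.inr i) = i) :
    ∃ R : Finset (V ⊕ I), Dominant r R ∧ R.card = Fintype.card I ∧ R.image c = univ := by
  classical
  by_contra! hno
  obtain ⟨i₀⟩ : Nonempty I := Fintype.card_pos_iff.1 (by omega)
  set rooms : Finset (Finset (V ⊕ I)) :=
    univ.filter fun R => Dominant r R ∧ R.card = Fintype.card I with hrooms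
  set doors : Finset (Finset (V ⊕ I)) :=
    univ.filter fun D => Dominant r D ∧ D.card + 1 = Fintype.card I ∧
      D.image c = univ.erase i₀ with hdoors
  -- Incidences are counted twice. If no room has all the colours, every room has an even number of
  -- doors; every door lies in two rooms, except the boundary one, which lies in a single room. The
  -- total would be both even and odd.
  have hcount := sum_card_bipartiteAbove_eq_sum_card_bipartiteBelow
    (s := doors) (t := rooms) (fun D R => D ⊆ R)
  have hbelow : ∀ R ∈ rooms, Even (doors.bipartiteBelow (fun D R => D ⊆ R) R).card := by
    intro R hR
    simp only [hrooms, mem_filter, mem_univ, true_and] at hR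
    have := even_card_removable c i₀ hR.2 (hno R hR.1 hR.2)
    convert this using 1
    symm
    apply card_bij (fun x _ => R.erase x)
    · intro x hx
      obtain ⟨hxR, hx⟩ := mem_filter.1 hx
      simp only [bipartiteBelow, hdoors, mem_filter, mem_univ, true_and]
      refine ⟨⟨hR.1.mono (erase_subset _ _), ?_, hx⟩, erase_subset _ _⟩
      rw [card_erase_of_mem hxR, hR.2]
      omega
    · intro x hx y hy hxy
      by_contra hne
      have : x ∈ R.erase y := mem_erase.2 ⟨hne, (mem_filter.1 hx).1⟩
      rw [← hxy] at this
      exact (mem_erase.1 this).1 rfl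
    · intro D hD
      simp only [bipartiteBelow, hdoors, mem_filter, mem_univ, true_and] at hD
      obtain ⟨⟨hDd, hDc, hDi⟩, hDR⟩ := hD
      obtain ⟨x, hx, hDx⟩ : ∃ x ∈ R, D = R.erase x := by
        have : (R \ D).card = 1 := by
          rw [card_sdiff_of_subset hDR]
          omega
        obtain ⟨x, hx⟩ := card_eq_one.1 this
        have hxm : x ∈ R \ D := hx ▸ mem_singleton_self x
        refine ⟨x, (mem_sdiff.1 hxm).1, ?_⟩
        rw [erase_eq, ← hx, Finset.sdiff_sdiff_eq_self hDR]
      subst hDx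
      exact ⟨x, mem_filter.2 ⟨hx, hDi⟩, rfl⟩
  have habove : ∀ D ∈ doors, (rooms.bipartiteAbove (fun D R => D ⊆ R) D).card =
      if D = (univ.erase i₀).map Function.Embedding.inr then 1 else 2 := by
    intro D hD
    simp only [hdoors, mem_filter, mem_univ, true_and] at hD
    obtain ⟨hDd, hDc, hDi⟩ := hD
    have hcard : (univ.filter fun y => y ∉ D ∧ Dominant r (insert y D)).card
        = (rooms.bipartiteAbove (fun D R => D ⊆ R) D).card := by
      apply card_bij (fun y _ => insert y D)
      · intro y hy
        obtain ⟨hyD, hy⟩ := (mem_filter.1 hy).2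
        simp only [bipartiteAbove, hrooms, mem_filter, mem_univ, true_and]
        exact ⟨⟨hy, by rw [card_insert_of_notMem hyD, hDc]⟩, subset_insert _ _⟩
      · intro x hx y hy hxy
        have := mem_insert_self x D
        rw [hxy] at this
        exact (mem_insert.1 this).resolve_right (mem_filter.1 hx).2.1
      · intro R hR
        simp only [bipartiteAbove, hrooms, mem_filter, mem_univ, true_and] at hR
        obtain ⟨⟨hRd, hRc⟩, hDR⟩ := hR
        have : (R \ D).card = 1 := by
          rw [card_sdiff_of_subset hDR]
          omega
        obtain ⟨x, hx⟩ := card_eq_one.1 this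
        have hxm : x ∈ R \ D := hx ▸ mem_singleton_self x
        have hRx : insert x D = R := by
          rw [insert_eq, ← hx, sdiff_union_of_subset hDR]
        exact ⟨x, mem_filter.2 ⟨mem_univ _, (mem_sdiff.1 hxm).2, hRx ▸ hRd⟩, hRx⟩
    rw [← hcard]
    split_ifs with hb
    · exact hr.card_extensions_boundary hI i₀ hb
    -- A slack point has its own index as colour, so a door made of slack points only is the
    -- boundary one.
    · obtain ⟨v, hv⟩ : ∃ v, Sum.inl v ∈ D := by
        by_contra! hn
        apply hb
        rw [← hDi]
        ext x
        rcases x with v | k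
        · simp [hn]
        · simp only [mem_map, mem_image, Function.Embedding.inr_apply, Sum.inr.injEq,
            exists_eq_right]
          refine ⟨fun hk => ⟨_, hk, hc k⟩, ?_⟩
          rintro ⟨v | l, hl, hlk⟩
          · exact absurd hl (hn v)
          · rw [hc] at hlk
            exact hlk ▸ hl
      exact hr.card_extensions_of_mem hDd hDc hv
  rw [sum_congr rfl habove] at hcount
  have hev : Even (∑ R ∈ rooms, (doors.bipartiteBelow (fun D R => D ⊆ R) R).card) :=
    even_sum _ hbelow
  rw [← hcount, sum_ite] at hev
  have hone : (doors.filter fun D => D = (univ.erase i₀).map Function.Embedding.inr)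
      = {(univ.erase i₀).map Function.Embedding.inr} := by
    ext D
    simp only [mem_filter, mem_singleton, and_iff_right_iff_imp]
    rintro rfl
    simp only [hdoors, mem_filter, mem_univ, true_and]
    refine ⟨hr.dominant_boundary i₀, ?_, ?_⟩
    · rw [card_map, card_erase_of_mem (mem_univ _), card_univ]
      omega
    · ext k
      simp [hc]
  rw [hone] at hev
  simp only [sum_const, card_singleton, smul_eq_mul, mul_one] at hev
  rw [Nat.even_add] at hev
  simp at hev

/-- Scarf's lemma, for finitely many rankings `r i` of a finite set: for every colouring by the
rankings there is a set `X` whose set of colours `C` is such that no `y` is strictly above `X` for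
all the rankings in `C`. -/
theorem exists_dominant_colouring [Nonempty V] (hI : 1 < Fintype.card I) (r : I → V → ℕ)
    (hr : ∀ i, Function.Injective (r i)) (c : V → I) :
    ∃ X : Finset V, X.Nonempty ∧ ∀ y, ∃ i ∈ X.image c, ∀ x ∈ X, r i y ≤ r i x := by
  classical
  obtain ⟨M, hM⟩ : ∃ M, ∀ i v, r i v < M := by
    refine ⟨(univ.sup fun p : I × V => r p.1 p.2) + 1, fun i v => Nat.lt_succ_of_le ?_⟩
    exact le_sup (f := fun p : I × V => r p.1 p.2) (mem_univ (i, v))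
  let e := Fintype.equivFin I
  -- The shift by one leaves the value `0` to the slack point `i`; the other slack points get
  -- distinct values above those of `V`.
  let r' : I → V ⊕ I → ℕ := fun i w => Sum.elim (fun v => r i v + 1)
    (fun j => if j = i then 0 else M + 1 + e j) w
  have hr' : IsSlack r' := by
    constructor
    · rintro i (v | j) (w | k) h
      · simp only [r', Sum.elim_inl, add_left_inj] at h
        rw [hr i h]
      · have := hM i v
        simp only [r', Sum.elim_inl, Sum.elim_inr] at h
        split_ifs at h
        omega
      · have := hM i w
        simp only [r', Sum.elim_inl, Sum.elim_inr] at h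
        split_ifs at h
        omega
      · simp only [r', Sum.elim_inr] at h
        split_ifs at h with h1 h2 h2
        · rw [h1, h2]
        · omega
        · omega
        · congr 1
          exact e.injective (Fin.ext (by omega))
    · rintro i (w | k) h
      · simp [r']
      · have : k ≠ i := by simpa using h
        simp [r', this]
    · intro i j v hij
      have := hM i v
      simp only [r', Sum.elim_inl, Sum.elim_inr, if_neg hij.symm]
      omega
  obtain ⟨R, hR, hcard, himg⟩ := hr'.exists_dominant_rainbow hI (Sum.elim c id) fun i => rfl
  set X : Finset V := univ.filter fun v => Sum.inl v ∈ R with hX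
  have hmemX : ∀ v, v ∈ X ↔ Sum.inl v ∈ R := by simp [hX]
  -- The ranking that blocks a point of `V` cannot be one whose slack point, of value `0`, lies in
  -- `R`. Its colour must then be supplied by `X`.
  have key : ∀ y, ∃ i, Sum.inr i ∉ R ∧ ∀ x ∈ X, r i y ≤ r i x := by
    intro y
    obtain ⟨i, hi⟩ := hR (Sum.inl y)
    refine ⟨i, fun hiR => ?_, fun x hx => ?_⟩
    · have := hi _ hiR
      simp [r'] at this
    · have := hi _ ((hmemX x).1 hx)
      simpa [r'] using this
  have hcol : ∀ i, Sum.inr i ∉ R → i ∈ X.image c := by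
    intro i hi
    have : i ∈ R.image (Sum.elim c id) := himg ▸ mem_univ i
    obtain ⟨v | j, hv, hvi⟩ := mem_image.1 this
    · exact mem_image.2 ⟨v, (hmemX v).2 hv, hvi⟩
    · have : j = i := hvi
      exact absurd (this ▸ hv) hi
  refine ⟨X, ?_, fun y => (key y).imp fun i hi => ⟨hcol i hi.1, hi.2⟩⟩
  obtain ⟨v⟩ := ‹Nonempty V›
  obtain ⟨i, hi, -⟩ := key v
  exact (image_nonempty.1 ⟨i, hcol i hi⟩)

end Scarf

/-! ### The covering theorem on the simplex. -/

namespace Scarf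

open Finset

variable {L : Type*} [Fintype L]

/-- The points with integer coordinates of the dilated simplex. -/
abbrev Grid (L : Type*) [Fintype L] (k : ℕ) : Type _ :=
  {y : L → Fin (k + 1) // ∑ l, (y l : ℕ) = k}

lemma exists_grid {k : ℕ} (y : L → ℕ) (hy : ∑ l, y l = k) : ∃ v : Grid L k, ∀ l, (v.1 l : ℕ) = y l :=
  ⟨⟨fun l => ⟨y l, Nat.lt_succ_of_le (hy ▸ single_le_sum (fun _ _ => Nat.zero_le _) (mem_univ l))⟩,
    hy⟩, fun _ => rfl⟩

/-- The integer points of `X` are close to each other, and their coordinates that are not colours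
are small. -/
lemma exists_grid_colouring [DecidableEq L] (hL : 1 < Fintype.card L) (k : ℕ) (c : Grid L k → L) :
    ∃ X : Finset (Grid L k), X.Nonempty ∧ ∃ b : L → ℕ, (∀ l, l ∉ X.image c → b l = 0) ∧
      ∀ x ∈ X, ∀ l, b l ≤ x.1 l ∧ (x.1 l : ℕ) ≤ b l + Fintype.card L := by
  obtain ⟨l₀⟩ : Nonempty L := Fintype.card_pos_iff.1 (by omega)
  have : Nonempty (Grid L k) :=
    (exists_grid (fun l => if l = l₀ then k else 0) (by simp)).nonempty
  let e := Fintype.equivFin (Grid L k)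
  set M := Fintype.card (Grid L k) with hM
  -- The rankings are the coordinates, with ties broken by the enumeration `e`.
  obtain ⟨X, hX, hdom⟩ := exists_dominant_colouring hL
    (fun i (y : Grid L k) => (y.1 i : ℕ) * M + e y) (by
      intro i y z h
      apply e.injective
      apply Fin.ext
      have := congrArg (· % M) h
      simpa [Nat.mod_eq_of_lt (e y).2, Nat.mod_eq_of_lt (e z).2] using this) c
  set b : L → ℕ := fun l => if l ∈ X.image c then X.inf' hX fun x => (x.1 l : ℕ) else 0 with hb
  have hbx : ∀ x ∈ X, ∀ l, b l ≤ x.1 l := by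
    intro x hx l
    simp only [hb]
    split_ifs
    · exact inf'_le (fun x : Grid L k => (x.1 l : ℕ)) hx
    · exact Nat.zero_le _
  -- Otherwise some grid point would have all its coordinates at least `b l + 1`, strictly above the
  -- minimum of `X` for every colour. As the coordinates of a point of `X` sum to `k` and are at
  -- least `b`, none can then exceed `b` by more than the number of coordinates.
  have hsum : k < ∑ l, (b l + 1) := by
    by_contra! hle
    obtain ⟨x₀, hx₀⟩ := hX
    obtain ⟨y, hy⟩ := exists_grid (k := k) (fun l => b l + 1 + if l = l₀ then k - ∑ l, (b l + 1) else 0)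
      (by rw [sum_add_distrib, sum_ite_eq' univ l₀, if_pos (mem_univ _)]; omega)
    obtain ⟨i, hi, hdi⟩ := hdom y
    obtain ⟨x, hx, hxi⟩ := exists_mem_eq_inf' ⟨x₀, hx₀⟩ (fun x : Grid L k => (x.1 i : ℕ))
    have hbi : b i = x.1 i := by simp only [hb, if_pos hi, hxi]
    have h1 := hdi x hx
    have h2 : (x.1 i : ℕ) + 1 ≤ y.1 i := by
      rw [hy, ← hbi]
      omega
    have h3 := Nat.mul_le_mul_right M h2
    have h4 := (e x).2
    rw [add_mul] at h3
    omega
  refine ⟨X, hX, b, fun l hl => by simp only [hb, if_neg hl], fun x hx l => ⟨hbx x hx l, ?_⟩⟩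
  have h1 : ∑ l ∈ univ.erase l, b l ≤ ∑ l ∈ univ.erase l, (x.1 l : ℕ) :=
    sum_le_sum fun l _ => hbx x hx l
  have h2 := x.2
  rw [← add_sum_erase _ _ (mem_univ l)] at h2
  rw [sum_add_distrib, ← add_sum_erase _ _ (mem_univ l)] at hsum
  simp only [sum_const, card_univ, smul_eq_mul, mul_one] at hsum
  omega

lemma grid_mem_stdSimplex {k : ℕ} (hk : 0 < k) (x : Grid L k) :
    (fun l => (x.1 l : ℝ) / k) ∈ stdSimplex ℝ L := by
  refine ⟨fun l => by positivity, ?_⟩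
  rw [← sum_div]
  have : ((∑ l, (x.1 l : ℕ) : ℕ) : ℝ) = k := by rw [x.2]
  push_cast at this
  rw [this, div_self (by positivity)]

/-- Every grid point is coloured by a set containing it. Any point of the resulting `X` is close to
one in `A l` for each colour `l`, and its other coordinates are small. -/
lemma exists_approx (A : L → Set (L → ℝ)) (hL : 1 < Fintype.card L)
    (hcover : ∀ x ∈ stdSimplex ℝ L, ∃ l, x ∈ A l) {k : ℕ} (hk : 0 < k) :
    ∃ z ∈ stdSimplex ℝ L, ∀ l, z l ≤ Fintype.card L / k ∨
      ∃ a ∈ A l, dist z a ≤ Fintype.card L / k := by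
  classical
  choose c hc using fun x : Grid L k => hcover _ (grid_mem_stdSimplex hk x)
  obtain ⟨X, ⟨x, hx⟩, b, hb0, hb⟩ := exists_grid_colouring hL k c
  have hk' : (0 : ℝ) < k := by exact_mod_cast hk
  refine ⟨_, grid_mem_stdSimplex hk x, fun l => ?_⟩
  by_cases hl : l ∈ X.image c
  · right
    obtain ⟨x', hx', rfl⟩ := mem_image.1 hl
    refine ⟨_, hc x', ?_⟩
    rw [dist_pi_le_iff (by positivity)]
    intro i
    have h1 := hb x hx i
    have h2 := hb x' hx' i
    rw [Real.dist_eq, ← sub_div, abs_div, abs_of_pos hk']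
    gcongr
    have h3 : ((x.1 i : ℕ) : ℝ) ≤ (x'.1 i : ℕ) + (Fintype.card L : ℕ) := by
      exact_mod_cast (by omega : (x.1 i : ℕ) ≤ (x'.1 i : ℕ) + Fintype.card L)
    have h4 : ((x'.1 i : ℕ) : ℝ) ≤ (x.1 i : ℕ) + (Fintype.card L : ℕ) := by
      exact_mod_cast (by omega : (x'.1 i : ℕ) ≤ (x.1 i : ℕ) + Fintype.card L)
    rw [abs_le]
    constructor <;> linarith
  · left
    have h1 := hb x hx l
    rw [hb0 l hl] at h1
    gcongr
    exact_mod_cast (by omega : (x.1 l : ℕ) ≤ Fintype.card L)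

open Filter Topology in
/-- If closed sets cover the simplex, some point belongs to all the sets whose index is in its
support. -/
theorem exists_mem_of_cover [Nonempty L] (A : L → Set (L → ℝ)) (hA : ∀ l, IsClosed (A l))
    (hcover : ∀ x ∈ stdSimplex ℝ L, ∃ l, x ∈ A l) :
    ∃ x ∈ stdSimplex ℝ L, ∀ l, 0 < x l → x ∈ A l := by
  classical
  rcases Nat.lt_or_ge 1 (Fintype.card L) with hL | hL
  · choose z hz hzA using fun k : ℕ => exists_approx A hL hcover k.succ_pos
    -- An ultrafilter decides, for each `l`, which alternative of `hzA` persists, without extracting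
    -- subsequences.
    set U : Ultrafilter ℕ := hyperfilter ℕ
    have hU : (U : Filter ℕ) ≤ atTop := by
      rw [← Nat.cofinite_eq_atTop]
      exact hyperfilter_le_cofinite
    obtain ⟨x, hx, hlim⟩ := (isCompact_stdSimplex ℝ L).ultrafilter_le_nhds (U.map z)
      (le_principal_iff.2 (show ∀ᶠ k in (U : Filter ℕ), z k ∈ stdSimplex ℝ L from Eventually.of_forall hz))
    have hlim : Tendsto z U (𝓝 x) := hlim
    have hsmall : Tendsto (fun k : ℕ => (Fintype.card L : ℝ) / (k.succ : ℕ)) U (𝓝 0) :=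
      (((tendsto_const_div_atTop_nhds_zero_nat _).comp (tendsto_add_atTop_nat 1))).mono_left hU
    refine ⟨x, hx, fun l hl => ?_⟩
    rcases Ultrafilter.eventually_or.1 (Eventually.of_forall (f := (U : Filter ℕ))
      fun k => hzA k l) with h | h
    · exact absurd (le_of_tendsto_of_tendsto (tendsto_pi_nhds.1 hlim l) hsmall h) (not_le.2 hl)
    · obtain ⟨a, ha⟩ := h.choice
      refine (hA l).mem_of_tendsto (f := a) (b := (U : Filter ℕ)) ?_ (ha.mono fun k hk => hk.1)
      refine tendsto_of_tendsto_of_dist hlim ?_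
      exact squeeze_zero' (Eventually.of_forall fun _ => dist_nonneg) (ha.mono fun k hk => hk.2)
        hsmall
  · have : Subsingleton L := Fintype.card_le_one_iff_subsingleton.1 hL
    obtain ⟨l⟩ := ‹Nonempty L›
    obtain ⟨l', hl'⟩ := hcover _ (single_mem_stdSimplex ℝ l)
    exact ⟨_, single_mem_stdSimplex ℝ l, fun i _ => Subsingleton.elim l' i ▸ hl'⟩

end Scarf

/-! ### Controls as lists and dynamic programming. -/

namespace SwitchingMFG

variable {N : ℕ} {T : ℝ} {G : Costs N T} {ρ : MassTuple N T}

/-- The admissible lists of the successive pairs (new node, switching instant). -/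
def IsControlList (T : ℝ) : Node N → ℝ → List (Node N × ℝ) → Prop
  | p, t, [] => p = dest N ∨ t = T
  | p, t, a :: l => (a.1 ∈ next p ∧ a.2 ∈ Set.Ioc t T) ∧ IsControlList T a.1 a.2 l

/-- The cost of a list of switches. -/
noncomputable def listCost (G : Costs N T) (ρ : MassTuple N T) :
    Node N → ℝ → List (Node N × ℝ) → ℝ
  | p, t, [] => G.Cfin p t
  | p, t, a :: l => G.C p a.1 t a.2 ρ + listCost G ρ a.1 a.2 l

lemma next_dest (q : Node N) : q ∉ next (dest N) := by
  rintro ⟨i, hi, -⟩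
  simp [dest] at hi

lemma exists_mem_next {p : Node N} (hp : p ≠ dest N) : ∃ q, q ∈ next p := by
  by_contra! h
  apply hp
  funext i
  by_contra hi
  exact h _ ⟨i, by simpa [dest] using hi, rfl⟩

/-- A control with at least one switch, from its first switch on. -/
def Control.tail {p : Node N} {t : ℝ} (c : Control N T p t) (r : ℕ) (hr : c.r = r + 1) :
    Control N T (c.π ⟨1, by omega⟩) (c.σ ⟨1, by omega⟩) where
  r := r
  σ i := c.σ ⟨i + 1, by omega⟩
  π i := c.π ⟨i + 1, by omega⟩
  σ_zero := rfl
  π_zero := rfl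
  σ_strictMono i j h := c.σ_strictMono (Fin.lt_def.2 (Nat.add_lt_add_right (Fin.lt_def.1 h) 1))
  σ_le := by
    convert c.σ_le using 3
    simp [hr]
  π_step i := c.π_step ⟨i + 1, by omega⟩
  σ_last h := by
    have h1 : (⟨(Fin.last r : Fin (r + 1)) + 1, by rw [Fin.val_last]; omega⟩ : Fin (c.r + 1)) = Fin.last c.r := by
      ext
      simp [hr]
    rw [h1] at h ⊢
    exact c.σ_last h

lemma Control.J_eq {p : Node N} {t : ℝ} (c : Control N T p t) (r : ℕ) (hr : c.r = r + 1) :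
    J G ρ c = G.C p (c.π ⟨1, by omega⟩) t (c.σ ⟨1, by omega⟩) ρ + J G ρ (c.tail r hr) := by
  obtain ⟨r', σ, π, hσ, hπ, hmono, hle, hstep, hlast⟩ := c
  dsimp only at hr
  subst hr
  subst hπ
  subst hσ
  simp only [J, Control.tail, Fin.sum_univ_succ]
  rw [add_assoc]
  rfl

/-- With `exists_control`, this replaces controls by lists, whose recursion on the first switch
matches that of `IsOptimalPath`. -/
lemma exists_isControlList : ∀ (r : ℕ) {p : Node N} {t : ℝ} (c : Control N T p t), c.r = r →
    ∃ l, IsControlList T p t l ∧ listCost G ρ p t l = J G ρ c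
  | 0, p, t, c, hr => by
    obtain ⟨r', σ, π, hσ, hπ, hmono, hle, hstep, hlast⟩ := c
    dsimp only at hr
    subst hr
    refine ⟨[], ?_, ?_⟩
    · by_cases hp : p = dest N
      · exact Or.inl hp
      · right
        have : π (Fin.last 0) = p := hπ
        rw [← hlast (by rwa [this])]
        exact hσ.symm
    · have h1 : π (Fin.last 0) = p := hπ
      have h2 : σ (Fin.last 0) = t := hσ
      simp only [listCost, J, Finset.univ_eq_empty, Finset.sum_empty, zero_add, h1, h2]
  | r + 1, p, t, c, hr => by
    obtain ⟨l, hl, hcost⟩ := exists_isControlList r (c.tail r hr) rfl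
    refine ⟨(c.π ⟨1, by omega⟩, c.σ ⟨1, by omega⟩) :: l, ⟨⟨?_, ?_, ?_⟩, hl⟩, ?_⟩
    · exact (congrArg (fun q => c.π ⟨1, by omega⟩ ∈ next q) c.π_zero).mp
        (c.π_step ⟨0, by omega⟩)
    · calc t = c.σ 0 := c.σ_zero.symm
        _ < c.σ ⟨1, by omega⟩ := c.σ_strictMono (by simp [Fin.lt_def])
    · exact (c.σ_strictMono.monotone (Fin.le_last _)).trans c.σ_le
    · rw [c.J_eq r hr, ← hcost]
      rfl

/-- The control that performs a first switch and then follows `c`. -/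
def Control.cons {p : Node N} {t : ℝ} {a : Node N × ℝ} (ha : a.1 ∈ next p ∧ a.2 ∈ Set.Ioc t T)
    (c : Control N T a.1 a.2) : Control N T p t where
  r := c.r + 1
  σ := Fin.cons t c.σ
  π := Fin.cons p c.π
  σ_zero := rfl
  π_zero := rfl
  σ_strictMono := by
    rw [Fin.strictMono_iff_lt_succ]
    intro i
    induction i using Fin.cases with
    | zero =>
      rw [Fin.castSucc_zero, Fin.cons_zero, Fin.cons_succ, c.σ_zero]
      exact ha.2.1
    | succ i =>
      rw [← Fin.succ_castSucc, Fin.cons_succ, Fin.cons_succ]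
      exact c.σ_strictMono (Fin.castSucc_lt_succ)
  σ_le := by
    rw [← Fin.succ_last, Fin.cons_succ]
    exact c.σ_le
  π_step i := by
    induction i using Fin.cases with
    | zero =>
      rw [Fin.castSucc_zero, Fin.cons_zero, Fin.cons_succ, c.π_zero]
      exact ha.1
    | succ i =>
      rw [← Fin.succ_castSucc, Fin.cons_succ, Fin.cons_succ]
      exact c.π_step i
  σ_last := by
    rw [← Fin.succ_last, Fin.cons_succ, Fin.cons_succ]
    exact c.σ_last

lemma Control.J_cons {p : Node N} {t : ℝ} {a : Node N × ℝ}
    (ha : a.1 ∈ next p ∧ a.2 ∈ Set.Ioc t T) (c : Control N T a.1 a.2) :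
    J G ρ (Control.cons ha c) = G.C p a.1 t a.2 ρ + J G ρ c := by
  change (∑ i : Fin (c.r + 1), G.C ((Fin.cons p c.π : Fin (c.r + 2) → Node N) i.castSucc)
    ((Fin.cons p c.π : Fin (c.r + 2) → Node N) i.succ)
    ((Fin.cons t c.σ : Fin (c.r + 2) → ℝ) i.castSucc)
    ((Fin.cons t c.σ : Fin (c.r + 2) → ℝ) i.succ) ρ) + G.Cfin (c.π (Fin.last c.r))
      (c.σ (Fin.last c.r)) = _
  simp only [J, Fin.sum_univ_succ, Fin.cons_succ, Fin.castSucc_zero, Fin.cons_zero,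
    ← Fin.succ_castSucc, c.π_zero, c.σ_zero, add_assoc]

lemma exists_control : ∀ (l : List (Node N × ℝ)) {p : Node N} {t : ℝ}, t ≤ T →
    IsControlList T p t l → ∃ c : Control N T p t, J G ρ c = listCost G ρ p t l
  | [], p, t, ht, h =>
    ⟨{  r := 0
        σ := fun _ => t
        π := fun _ => p
        σ_zero := rfl
        π_zero := rfl
        σ_strictMono := Subsingleton.strictMono (α := Fin 1) _
        σ_le := ht
        π_step := fun i => i.elim0
        σ_last := fun hp => h.resolve_left hp }, by simp [J, listCost]⟩
  | a :: l, p, t, _, h => by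
    obtain ⟨c, hc⟩ := exists_control l h.1.2.2 h.2
    exact ⟨Control.cons h.1 c, by rw [Control.J_cons, hc]; rfl⟩

/-- One switch at time `T` is always enough. Existence matters for `V`, since a real infimum over an
empty family is `0` by default. -/
lemma exists_isControlList_from (p : Node N) {t : ℝ} (ht : t ≤ T) :
    ∃ l, IsControlList T p t l := by
  by_cases hp : p = dest N
  · exact ⟨[], Or.inl hp⟩
  rcases ht.eq_or_lt with rfl | ht
  · exact ⟨[], Or.inr rfl⟩
  obtain ⟨q, hq⟩ := exists_mem_next hp
  exact ⟨[(q, T)], ⟨hq, ht, le_rfl⟩, Or.inr rfl⟩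

lemma listCost_ge (hG : StandingHypotheses G) (hρ : ρ ∈ massSpace N T) {B : ℝ}
    (hB : ∀ p, ∀ t ∈ Set.Icc 0 T, |G.Cfin p t| ≤ B) :
    ∀ (l : List (Node N × ℝ)) {p : Node N} {t : ℝ}, t ∈ Set.Icc 0 T → IsControlList T p t l →
      -B ≤ listCost G ρ p t l
  | [], p, t, ht, _ => (abs_le.1 (hB p t ht)).1
  | a :: l, p, t, ht, h => by
    have h1 := hG.nonneg p a.1 h.1.1 t a.2 ht.1 h.1.2.1 h.1.2.2 ρ hρ
    have h2 := listCost_ge hG hρ hB l (p := a.1) (t := a.2) ⟨ht.1.trans h.1.2.1.le, h.1.2.2⟩ h.2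
    simp only [listCost]
    linarith

lemma V_le (hG : StandingHypotheses G) (hρ : ρ ∈ massSpace N T) {l : List (Node N × ℝ)}
    {p : Node N} {t : ℝ} (ht : t ∈ Set.Icc 0 T) (hl : IsControlList T p t l) :
    V G ρ p t ≤ listCost G ρ p t l := by
  obtain ⟨B, hB⟩ := hG.fin_bounded
  obtain ⟨c, hc⟩ := exists_control (G := G) (ρ := ρ) l ht.2 hl
  rw [← hc]
  -- The costs are bounded below because switching costs are nonnegative and final costs bounded.
  refine ciInf_le ⟨-B, ?_⟩ c
  rintro _ ⟨c', rfl⟩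
  obtain ⟨l', hl', hcost⟩ := exists_isControlList (G := G) (ρ := ρ) _ c' rfl
  dsimp only
  rw [← hcost]
  exact listCost_ge hG hρ hB l' ht hl'

lemma le_V {p : Node N} {t : ℝ} (ht : t ≤ T) {x : ℝ}
    (h : ∀ l, IsControlList T p t l → x ≤ listCost G ρ p t l) : x ≤ V G ρ p t := by
  obtain ⟨l, hl⟩ := exists_isControlList_from p ht
  obtain ⟨c, -⟩ := exists_control (G := G) (ρ := ρ) l ht hl
  have : Nonempty (Control N T p t) := ⟨c⟩
  refine le_ciInf fun c' => ?_
  obtain ⟨l', hl', hcost⟩ := exists_isControlList (G := G) (ρ := ρ) _ c' rfl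
  rw [← hcost]
  exact h l' hl'

/-- Lists of switches with the least cost. -/
def IsMinimizing (G : Costs N T) (ρ : MassTuple N T) (p : Node N) (t : ℝ)
    (l : List (Node N × ℝ)) : Prop :=
  IsControlList T p t l ∧ ∀ l', IsControlList T p t l' → listCost G ρ p t l ≤ listCost G ρ p t l'

lemma IsMinimizing.V_eq (hG : StandingHypotheses G) (hρ : ρ ∈ massSpace N T)
    {l : List (Node N × ℝ)} {p : Node N} {t : ℝ} (ht : t ∈ Set.Icc 0 T)
    (hl : IsMinimizing G ρ p t l) : V G ρ p t = listCost G ρ p t l :=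
  le_antisymm (V_le hG hρ ht hl.1) (le_V ht.2 hl.2)

/-- Dynamic programming: the optimal paths are the lists of switches with the least cost. -/
theorem isOptimalPath_iff (hG : StandingHypotheses G) (hρ : ρ ∈ massSpace N T) :
    ∀ (l : List (Node N × ℝ)) {p : Node N} {t : ℝ}, t ∈ Set.Icc 0 T →
      (IsOptimalPath G ρ p t l ↔ IsMinimizing G ρ p t l)
  | [], p, t, _ => by
    refine ⟨fun h => ⟨h, ?_⟩, fun h => h.1⟩
    rintro (_ | ⟨b, l'⟩) hl'
    · exact le_rfl
    · rcases h with rfl | rfl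
      · exact absurd hl'.1.1 (next_dest _)
      · exact absurd hl'.1.2.1 (not_lt.2 hl'.1.2.2)
  | a :: l, p, t, ht => by
    have hmem : ∀ {b : Node N × ℝ}, b.2 ∈ Set.Ioc t T → b.2 ∈ Set.Icc 0 T := fun hb =>
      ⟨ht.1.trans hb.1.le, hb.2⟩
    constructor
    · rintro ⟨⟨ha, hopt⟩, hl⟩
      have hmin := (isOptimalPath_iff hG hρ l (hmem ha.2)).1 hl
      refine ⟨⟨ha, hmin.1⟩, ?_⟩
      rintro (_ | ⟨b, l'⟩) hl'
      · rcases hl' with rfl | rfl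
        · exact absurd ha.1 (next_dest _)
        · exact absurd ha.2.1 (not_lt.2 ha.2.2)
      · have h1 := hopt b hl'.1.1 hl'.1.2
        have h2 := V_le hG hρ (hmem hl'.1.2) hl'.2
        rw [hmin.V_eq hG hρ (hmem ha.2)] at h1
        simp only [listCost]
        linarith
    · rintro ⟨⟨ha, hl⟩, hopt⟩
      have hmin : IsMinimizing G ρ a.1 a.2 l := by
        refine ⟨hl, fun l' hl' => ?_⟩
        have := hopt (a :: l') ⟨ha, hl'⟩
        simpa [listCost] using this
      refine ⟨⟨ha, fun b hb hbt => ?_⟩, (isOptimalPath_iff hG hρ l (hmem ha.2)).2 hmin⟩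
      rw [hmin.V_eq hG hρ (hmem ha.2), ← sub_le_iff_le_add]
      -- No minimizer from `b` is needed: the comparison holds for every continuation `l'`, hence
      -- for the infimum.
      refine le_V hbt.2 fun l' hl' => ?_
      have := hopt (b :: l') ⟨⟨hb, hbt⟩, hl'⟩
      simp only [listCost] at this
      linarith

end SwitchingMFG

/-! ### Compactness of controls and closed graph of the rounded optimal paths. -/

namespace SwitchingMFG

open Filter Topology

variable {N : ℕ} {T : ℝ} {G : Costs N T} {ρ : MassTuple N T} {ι : Type*}

/-- Keeping both nearest points at a midpoint makes rounding a closed condition, stable under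
limits. -/
lemma mem_rounding_iff (hT : 0 < T) {m : ℕ} (hm : 0 < m) {τ : ℝ} (hτ : 0 ≤ τ) (k : Fin (m + 1)) :
    k ∈ rounding T m τ ↔ |τ - (k : ℕ) * (T / m)| ≤ T / m / 2 := by
  have hε : 0 < T / m := by positivity
  simp only [rounding, Set.mem_ofPred_eq]
  generalize T / m = ε at hε
  obtain ⟨x, rfl⟩ : ∃ x, τ = x * ε := ⟨τ / ε, by field_simp⟩
  have hx : 0 ≤ x := nonneg_of_mul_nonneg_left hτ hε
  rw [mul_div_cancel_right₀ _ hε.ne']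
  have h1 := Nat.floor_le hx
  have h2 := Nat.lt_floor_add_one x
  have e1 : ∀ y : ℝ, x * ε ≤ y * ε + ε / 2 ↔ x ≤ y + 1 / 2 := fun y => by
    rw [show y * ε + ε / 2 = (y + 1 / 2) * ε by ring, mul_le_mul_iff_left₀ hε]
  have e2 : ∀ y : ℝ, y * ε + ε / 2 ≤ x * ε ↔ y + 1 / 2 ≤ x := fun y => by
    rw [show y * ε + ε / 2 = (y + 1 / 2) * ε by ring, mul_le_mul_iff_left₀ hε]
  have e3 : |x * ε - (k : ℕ) * ε| ≤ ε / 2 ↔ |x - (k : ℕ)| ≤ 1 / 2 := by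
    rw [← sub_mul, abs_mul, abs_of_pos hε, show ε / 2 = 1 / 2 * ε by ring,
      mul_le_mul_iff_left₀ hε]
  rw [e1, e2, e3, abs_le]
  constructor
  · rintro (⟨hk, hle⟩ | ⟨hk, hle⟩)
    · rw [hk]
      constructor <;> linarith
    · have h3 := Nat.le_ceil x
      have h4 : (⌈x⌉₊ : ℝ) ≤ ⌊x⌋₊ + 1 := by exact_mod_cast Nat.ceil_le_floor_add_one x
      rw [hk]
      constructor <;> linarith
  · rintro ⟨h3, h4⟩
    have h5 : (k : ℕ) < ⌊x⌋₊ + 2 := by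
      have : ((k : ℕ) : ℝ) < ⌊x⌋₊ + 2 := by linarith
      exact_mod_cast this
    have h6 : ⌊x⌋₊ < (k : ℕ) + 1 := by
      have : (⌊x⌋₊ : ℝ) < (k : ℕ) + 1 := by linarith
      exact_mod_cast this
    rcases (by omega : (k : ℕ) = ⌊x⌋₊ ∨ (k : ℕ) = ⌊x⌋₊ + 1) with hk | hk
    · left
      rw [hk] at h4
      exact ⟨hk, by linarith⟩
    · right
      rw [hk] at h3
      push_cast at h3
      refine ⟨?_, by linarith⟩
      rw [hk, eq_comm, Nat.ceil_eq_iff (by omega)]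
      push_cast
      constructor <;> linarith

lemma rounding_nonempty (hT : 0 < T) {m : ℕ} (hm : 0 < m) {τ : ℝ} (hτ : τ ∈ Set.Icc 0 T) :
    (rounding T m τ).Nonempty := by
  have hm' : (0 : ℝ) < m := by exact_mod_cast hm
  have hx : τ / (T / m) ≤ m := by
    rw [div_le_iff₀ (by positivity)]
    field_simp
    exact hτ.2
  rcases le_total τ (⌊τ / (T / m)⌋₊ * (T / m) + (T / m) / 2) with h | h
  · exact ⟨⟨⌊τ / (T / m)⌋₊, Nat.lt_succ_of_le (Nat.floor_le_of_le hx)⟩, Or.inl ⟨rfl, h⟩⟩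
  · exact ⟨⟨⌈τ / (T / m)⌉₊, Nat.lt_succ_of_le (Nat.ceil_le.2 hx)⟩, Or.inr ⟨rfl, h⟩⟩

lemma rounding_of_tendsto (hT : 0 < T) {m : ℕ} (hm : 0 < m) {l : Filter ι} [l.NeBot] {s : ι → ℝ}
    {τ : ℝ} (hs : Tendsto s l (𝓝 τ)) (h0 : ∀ᶠ n in l, 0 ≤ s n) {k : Fin (m + 1)}
    (hk : ∀ᶠ n in l, k ∈ rounding T m (s n)) : k ∈ rounding T m τ := by
  rw [mem_rounding_iff hT hm (ge_of_tendsto hs h0)]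
  refine le_of_tendsto (hs.sub_const _).abs ?_
  filter_upwards [h0, hk] with n hn hkn
  exact (mem_rounding_iff hT hm hn k).1 hkn

lemma exists_tendsto_of_mem_Icc (U : Ultrafilter ι) {f : ι → ℝ} {a b : ℝ}
    (h : ∀ᶠ n in U, f n ∈ Set.Icc a b) : ∃ y ∈ Set.Icc a b, Tendsto f U (𝓝 y) :=
  isCompact_Icc.ultrafilter_le_nhds (U.map f) (le_principal_iff.2 h)

/-- The Lipschitz bound is uniform in the switching instant at distance `δ` from the decisions, so
`ss` need not converge. -/
lemma tendsto_C_sub (hG : StandingHypotheses G) {l : Filter ι} {ρs : ι → MassTuple N T}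
    (hρs : ∀ᶠ n in l, ρs n ∈ massSpace N T) (hρ : ρ ∈ massSpace N T) (hlim : Tendsto ρs l (𝓝 ρ))
    {p q : Node N} (hq : q ∈ next p) {ts ss : ι → ℝ} {t δ : ℝ} (hδ : 0 < δ) (h0 : 0 ≤ t)
    (ht : Tendsto ts l (𝓝 t)) (h1 : ∀ᶠ n in l, 0 ≤ ts n ∧ ts n + δ ≤ ss n ∧ ss n ≤ T)
    (h2 : ∀ᶠ n in l, t + δ ≤ ss n) :
    Tendsto (fun n => G.C p q (ts n) (ss n) (ρs n) - G.C p q t (ss n) ρ) l (𝓝 0) := by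
  obtain ⟨h₀, hh₀, hL⟩ := hG.lipschitz
  obtain ⟨L, -, hL⟩ := hL (min δ h₀ / 2) (by positivity) (by
    have := min_le_right δ h₀
    linarith)
  have hmin : min δ h₀ / 2 ≤ δ := by
    have := min_le_left δ h₀
    linarith
  have hto : Tendsto (fun n => L * (|ts n - t| + ‖ρs n - ρ‖)) l (𝓝 0) := by
    have e1 : Tendsto (fun n => |ts n - t|) l (𝓝 0) := by
      simpa using (ht.sub_const t).abs
    have e2 : Tendsto (fun n => ‖ρs n - ρ‖) l (𝓝 0) := by
      simpa using (hlim.sub_const ρ).norm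
    simpa using (e1.add e2).const_mul L
  refine squeeze_zero_norm' ?_ hto
  filter_upwards [h1, h2, hρs] with n hn hn' hρn
  rw [Real.norm_eq_abs]
  exact hL p q hq (ss n) (by linarith) hn.2.2 (ts n) ⟨hn.1, by linarith⟩ t ⟨h0, by linarith⟩
    (ρs n) hρn ρ hρ

lemma tendsto_C (hG : StandingHypotheses G) {l : Filter ι} {ρs : ι → MassTuple N T}
    (hρs : ∀ᶠ n in l, ρs n ∈ massSpace N T) (hρ : ρ ∈ massSpace N T) (hlim : Tendsto ρs l (𝓝 ρ))
    {p q : Node N} (hq : q ∈ next p) {ts : ι → ℝ} {t s : ℝ} (ht : Tendsto ts l (𝓝 t))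
    (h0 : ∀ᶠ n in l, 0 ≤ ts n) (ht0 : 0 ≤ t) (hts : t < s) (hs : s ≤ T) :
    Tendsto (fun n => G.C p q (ts n) s (ρs n)) l (𝓝 (G.C p q t s ρ)) := by
  have := tendsto_C_sub hG hρs hρ hlim hq (δ := (s - t) / 2) (ss := fun _ => s) (by linarith) ht0 ht
    (by
      filter_upwards [h0, ht.eventually_lt_const (show t < (t + s) / 2 by linarith)] with n h1 h2
      exact ⟨h1, by linarith, hs⟩)
    (Eventually.of_forall fun _ => by linarith)
  simpa using this.add_const (G.C p q t s ρ)

/-- Joint lower semicontinuity of the switching cost. -/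
lemma C_le_of_tendsto (hG : StandingHypotheses G) {l : Filter ι} [l.NeBot] {ρs : ι → MassTuple N T}
    (hρs : ∀ᶠ n in l, ρs n ∈ massSpace N T) (hρ : ρ ∈ massSpace N T) (hlim : Tendsto ρs l (𝓝 ρ))
    {p q : Node N} (hq : q ∈ next p) {ts ss : ι → ℝ} {t s δ c : ℝ} (hδ : 0 < δ)
    (ht : Tendsto ts l (𝓝 t)) (hs : Tendsto ss l (𝓝 s))
    (h1 : ∀ᶠ n in l, 0 ≤ ts n ∧ ts n + δ ≤ ss n ∧ ss n ≤ T)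
    (hc : Tendsto (fun n => G.C p q (ts n) (ss n) (ρs n)) l (𝓝 c)) :
    G.C p q t s ρ ≤ c := by
  have ht0 : 0 ≤ t := ge_of_tendsto ht (h1.mono fun n hn => hn.1)
  have hsT : s ≤ T := le_of_tendsto hs (h1.mono fun n hn => hn.2.2)
  have hts : t + δ ≤ s := le_of_tendsto_of_tendsto (ht.add_const δ) hs (h1.mono fun n hn => hn.2.1)
  rcases hsT.lt_or_eq with hsT' | rfl
  · have hd := tendsto_C_sub hG hρs hρ hlim hq (δ := δ / 2) (by linarith) ht0 ht
      (h1.mono fun n hn => ⟨hn.1, by linarith [hn.2.1], hn.2.2⟩)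
      ((hs.eventually_const_lt (show t + δ / 2 < s by linarith)).mono fun n hn => hn.le)
    have hcont := ((hG.continuous_switch p q hq t ⟨ht0, by linarith⟩ ρ hρ).continuousAt
      (Ioo_mem_nhds (show t < s by linarith) hsT')).tendsto.comp hs
    have := hd.add hcont
    simp only [Function.comp_apply, sub_add_cancel, zero_add] at this
    exact (tendsto_nhds_unique this hc).le
  -- Continuity in the switching instant is given only before `T`. At `T`, monotonicity provides the
  -- inequality in the direction required.
  · have := tendsto_C hG hρs hρ hlim hq ht (h1.mono fun n hn => hn.1) ht0 (by linarith) le_rfl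
    refine le_of_tendsto_of_tendsto this hc ?_
    filter_upwards [h1, hρs] with n hn hρn
    exact hG.antitone p q hq (ts n) ⟨hn.1, by linarith⟩ (ρs n) hρn ⟨by linarith, hn.2.2⟩
      ⟨by linarith, le_rfl⟩ hn.2.2

/-- For a fixed list the gaps between switches are fixed, so the cost is continuous in the
distribution. This handles the competitors when optimality passes to the limit. -/
lemma tendsto_listCost (hG : StandingHypotheses G) {f : Filter ι} {ρs : ι → MassTuple N T}
    (hρs : ∀ᶠ n in f, ρs n ∈ massSpace N T) (hρ : ρ ∈ massSpace N T) (hlim : Tendsto ρs f (𝓝 ρ)) :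
    ∀ (l : List (Node N × ℝ)) {p : Node N} {t : ℝ}, 0 ≤ t → IsControlList T p t l →
      Tendsto (fun n => listCost G (ρs n) p t l) f (𝓝 (listCost G ρ p t l))
  | [], _, _, _, _ => tendsto_const_nhds
  | _ :: l, _, _, ht, h =>
    (tendsto_C hG hρs hρ hlim h.1.1 tendsto_const_nhds (Eventually.of_forall fun _ => ht) ht
      h.1.2.1 h.1.2.2).add (tendsto_listCost hG hρs hρ hlim l (ht.trans h.1.2.1.le) h.2)

/-- `l'` is obtained from `l` by rounding the switching instants. -/
abbrev IsRounding (T : ℝ) (m : ℕ) (l : List (Node N × ℝ)) (l' : List (Node N × Fin (m + 1))) :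
    Prop :=
  List.Forall₂ (fun a b => b.1 = a.1 ∧ b.2 ∈ rounding T m a.2) l l'

/-- Compactness of the controls of bounded cost, along an ultrafilter, with lower semicontinuity
of the cost. -/
theorem exists_limit_control (hG : StandingHypotheses G) (hT : 0 < T) {m : ℕ} (hm : 0 < m)
    (U : Ultrafilter ι) {ρs : ι → MassTuple N T} (hρs : ∀ᶠ n in U, ρs n ∈ massSpace N T)
    (hρ : ρ ∈ massSpace N T) (hlim : Tendsto ρs U (𝓝 ρ)) :
    ∀ (z : ℕ) (p : Node N), zeros p = z → ∀ (ts : ι → ℝ) (t x : ℝ) (ls : ι → List (Node N × ℝ)),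
      Tendsto ts U (𝓝 t) → (∀ᶠ n in U, ts n ∈ Set.Icc 0 T) →
      (∀ᶠ n in U, IsControlList T p (ts n) (ls n)) →
      Tendsto (fun n => listCost G (ρs n) p (ts n) (ls n)) U (𝓝 x) →
      ∃ l, IsControlList T p t l ∧ listCost G ρ p t l ≤ x ∧
        ∀ l', (∀ᶠ n in U, IsRounding T m (ls n) l') → IsRounding T m l l' := by
  intro z
  induction z using Nat.strong_induction_on with
  | _ z ih =>
  intro p hz ts t x ls ht htI hls hx
  have htI' : t ∈ Set.Icc 0 T := isClosed_Icc.mem_of_tendsto ht htI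
  have hcases : ∀ᶠ n in U, ls n = [] ∨ ∃ a : (Node N × ℝ) × List (Node N × ℝ),
      ls n = a.1 :: a.2 := Eventually.of_forall fun n => by
    rcases ls n with _ | ⟨a, l⟩
    · exact Or.inl rfl
    · exact Or.inr ⟨(a, l), rfl⟩
  rcases Ultrafilter.eventually_or.1 hcases with hnil | hcons
  · refine ⟨[], ?_, ?_, ?_⟩
    · have : ∀ᶠ n in U, p = dest N ∨ ts n = T := by
        filter_upwards [hnil, hls] with n h1 h2
        rw [h1] at h2
        exact h2
      rcases Ultrafilter.eventually_or.1 this with h | h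
      · exact Or.inl h.exists.choose_spec
      · exact Or.inr (tendsto_nhds_unique ht
          (tendsto_const_nhds.congr' (h.mono fun n hn => hn.symm)))
    · obtain ⟨K, hK⟩ := hG.fin_lipschitz
      have h1 : Tendsto (fun n => G.Cfin p (ts n)) U (𝓝 (G.Cfin p t)) :=
        ((hK p).continuousOn t htI').tendsto.comp (tendsto_nhdsWithin_iff.2 ⟨ht, htI⟩)
      refine (tendsto_nhds_unique (h1.congr' ?_) hx).le
      filter_upwards [hnil] with n hn
      simp [hn, listCost]
    · intro l' hl'
      obtain ⟨n, h1, h2⟩ := (hnil.and hl').exists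
      rwa [h1] at h2
  · obtain ⟨al, hal⟩ := hcons.choice
    -- There are finitely many nodes, so the next one is constant along `U`.
    obtain ⟨q, hq⟩ : ∃ q, ∀ᶠ n in U, (al n).1.1 = q := by
      rw [← Ultrafilter.eventually_exists_iff]
      exact Eventually.of_forall fun n => ⟨_, rfl⟩
    set ss : ι → ℝ := fun n => (al n).1.2
    set ls' : ι → List (Node N × ℝ) := fun n => (al n).2
    have hall : ∀ᶠ n in U, ls n = (q, ss n) :: ls' n := by
      filter_upwards [hal, hq] with n h1 h2
      rw [h1, ← h2]
    have hctl : ∀ᶠ n in U, (q ∈ next p ∧ ss n ∈ Set.Ioc (ts n) T) ∧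
        IsControlList T q (ss n) (ls' n) := by
      filter_upwards [hall, hls] with n h1 h2
      rw [h1] at h2
      exact h2
    have hqn : q ∈ next p := hctl.exists.choose_spec.1.1
    have hssI : ∀ᶠ n in U, ss n ∈ Set.Icc 0 T := by
      filter_upwards [hctl, htI] with n h1 h2
      exact ⟨h2.1.trans h1.1.2.1.le, h1.1.2.2⟩
    obtain ⟨s, hsI, hs⟩ := exists_tendsto_of_mem_Icc U hssI
    obtain ⟨B, hB⟩ := hG.fin_bounded
    have hcost : ∀ᶠ n in U, listCost G (ρs n) p (ts n) (ls n) =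
        G.C p q (ts n) (ss n) (ρs n) + listCost G (ρs n) q (ss n) (ls' n) := by
      filter_upwards [hall] with n hn
      rw [hn]
      rfl
    -- The total is eventually below `x + 1` and the tail costs at least `-B`.
    have hCI : ∀ᶠ n in U, G.C p q (ts n) (ss n) (ρs n) ∈ Set.Icc 0 (x + 1 + B) := by
      filter_upwards [hcost, hctl, hρs, htI, hssI, hx.eventually_lt_const (lt_add_one x)]
        with n h1 h2 h3 h4 h5 h6
      have h7 := listCost_ge hG h3 hB (ls' n) h5 h2.2
      exact ⟨hG.nonneg p q hqn _ _ h4.1 h2.1.2.1 h2.1.2.2 _ h3, by linarith⟩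
    obtain ⟨c, -, hc⟩ := exists_tendsto_of_mem_Icc U hCI
    -- A gap smaller than `δ` would push the switching cost beyond the bound in `hCI`; thus the
    -- limit switch is still strictly later than its decision.
    obtain ⟨δ, hδ, hblow⟩ := hG.blowup (x + 1 + B + 1)
    have hgap : ∀ᶠ n in U, 0 ≤ ts n ∧ ts n + δ ≤ ss n ∧ ss n ≤ T := by
      filter_upwards [hCI, hctl, hρs, htI] with n h1 h2 h3 h4
      refine ⟨h4.1, ?_, h2.1.2.2⟩
      by_contra! hlt
      have := hblow p q hqn (ts n) h4 (ss n) h2.1.2 hlt (ρs n) h3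
      linarith [h1.2]
    have htail : Tendsto (fun n => listCost G (ρs n) q (ss n) (ls' n)) U (𝓝 (x - c)) := by
      refine (hx.sub hc).congr' ?_
      filter_upwards [hcost] with n hn
      rw [hn]
      ring
    obtain ⟨l, hl, hlx, hlR⟩ := ih (zeros q) (hz ▸ zeros_lt hqn) q rfl ss s (x - c) ls' hs hssI
      (hctl.mono fun n hn => hn.2) htail
    have hts : t + δ ≤ s :=
      le_of_tendsto_of_tendsto (ht.add_const δ) hs (hgap.mono fun n hn => hn.2.1)
    refine ⟨(q, s) :: l, ⟨⟨hqn, ?_, hsI.2⟩, hl⟩, ?_, ?_⟩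
    · dsimp only
      linarith
    · have := C_le_of_tendsto hG hρs hρ hlim hqn hδ ht hs hgap hc
      simp only [listCost]
      linarith
    · intro l' hl'
      have hl'' : ∀ᶠ n in U, IsRounding T m ((q, ss n) :: ls' n) l' := by
        filter_upwards [hall, hl'] with n h1 h2
        rwa [h1] at h2
      rcases l' with _ | ⟨b, l'⟩
      · obtain ⟨n, hn⟩ := hl''.exists
        cases hn
      · simp only [List.forall₂_cons] at hl'' ⊢
        refine ⟨⟨hl''.exists.choose_spec.1.1, ?_⟩, hlR l' (hl''.mono fun n hn => hn.2)⟩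
        exact rounding_of_tendsto hT hm hs (hssI.mono fun n hn => hn.1)
          (hl''.mono fun n hn => hn.1.2)

lemma exists_isMinimizing (hG : StandingHypotheses G) (hT : 0 < T) (hρ : ρ ∈ massSpace N T)
    (j : Node N) : ∃ l, IsMinimizing G ρ j 0 l := by
  have h0 : (0 : ℝ) ∈ Set.Icc 0 T := ⟨le_rfl, hT.le⟩
  have hn : ∀ n : ℕ, ∃ l, IsControlList T j 0 l ∧
      listCost G ρ j 0 l < V G ρ j 0 + 1 / ((n : ℝ) + 1) := by
    intro n
    by_contra! h
    have := le_V hT.le h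
    have : (0 : ℝ) < 1 / ((n : ℝ) + 1) := by positivity
    linarith
  choose ls hls hcost using hn
  have hlim : Tendsto (fun n => listCost G ρ j 0 (ls n)) (hyperfilter ℕ : Ultrafilter ℕ)
      (𝓝 (V G ρ j 0)) := by
    have h1 : Tendsto (fun n : ℕ => V G ρ j 0 + 1 / ((n : ℝ) + 1)) atTop (𝓝 (V G ρ j 0)) := by
      simpa using tendsto_one_div_add_atTop_nhds_zero_nat.const_add (V G ρ j 0)
    refine (tendsto_of_tendsto_of_tendsto_of_le_of_le tendsto_const_nhds h1
      (fun n => V_le hG hρ h0 (hls n)) fun n => (hcost n).le).mono_left ?_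
    rw [← Nat.cofinite_eq_atTop]
    exact hyperfilter_le_cofinite
  -- Rounding plays no role here, and the partition with `m = 1` serves.
  obtain ⟨l, hl, hlx, -⟩ := exists_limit_control hG hT one_pos (hyperfilter ℕ)
    (Eventually.of_forall fun _ => hρ) hρ tendsto_const_nhds _ j rfl (fun _ => 0) 0 _ ls
    tendsto_const_nhds (Eventually.of_forall fun _ => h0) (Eventually.of_forall hls) hlim
  exact ⟨l, hl, fun l' hl' => hlx.trans (V_le hG hρ h0 hl')⟩

lemma exists_rounded (hT : 0 < T) {m : ℕ} (hm : 0 < m) :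
    ∀ (l : List (Node N × ℝ)) {p : Node N} {t : ℝ}, 0 ≤ t → IsControlList T p t l →
      ∃ l', IsRounding T m l l'
  | [], _, _, _, _ => ⟨[], List.Forall₂.nil⟩
  | a :: l, p, t, ht, h => by
    have h0 : 0 ≤ a.2 := ht.trans h.1.2.1.le
    obtain ⟨l', hl'⟩ := exists_rounded hT hm l h0 h.2
    obtain ⟨k, hk⟩ := rounding_nonempty hT hm ⟨h0, h.1.2.2⟩
    exact ⟨(a.1, k) :: l', List.Forall₂.cons ⟨rfl, hk⟩ hl'⟩

lemma epsPaths_nonempty (hG : StandingHypotheses G) (hT : 0 < T) {m : ℕ} (hm : 0 < m)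
    (hρ : ρ ∈ massSpace N T) (j : Node N) : (epsPaths G m ρ j).Nonempty := by
  obtain ⟨l, hl⟩ := exists_isMinimizing hG hT hρ j
  obtain ⟨l', hl'⟩ := exists_rounded hT hm l le_rfl hl.1
  exact ⟨l', l, (isOptimalPath_iff hG hρ l ⟨le_rfl, hT.le⟩).2 hl, hl'⟩

/-- The rounded optimal paths depend on the distribution with a closed graph. -/
theorem mem_epsPaths_of_tendsto (hG : StandingHypotheses G) (hT : 0 < T) {m : ℕ} (hm : 0 < m)
    (U : Ultrafilter ι) {ρs : ι → MassTuple N T} (hρs : ∀ᶠ n in U, ρs n ∈ massSpace N T)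
    (hρ : ρ ∈ massSpace N T) (hlim : Tendsto ρs U (𝓝 ρ)) {j : Node N}
    {l' : List (Node N × Fin (m + 1))} (hl' : ∀ᶠ n in U, l' ∈ epsPaths G m (ρs n) j) :
    l' ∈ epsPaths G m ρ j := by
  have h0 : (0 : ℝ) ∈ Set.Icc 0 T := ⟨le_rfl, hT.le⟩
  obtain ⟨ls, hls⟩ := hl'.choice
  have hmin : ∀ᶠ n in U, IsMinimizing G (ρs n) j 0 (ls n) := by
    filter_upwards [hls, hρs] with n h1 h2
    exact (isOptimalPath_iff hG h2 _ h0).1 h1.1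
  obtain ⟨B, hB⟩ := hG.fin_bounded
  obtain ⟨l₀, hl₀⟩ := exists_isControlList_from j hT.le
  -- The least costs are bounded above through the fixed competitor `l₀`, so they converge along
  -- `U`.
  obtain ⟨x, -, hx⟩ := exists_tendsto_of_mem_Icc U (a := -B) (b := listCost G ρ j 0 l₀ + 1)
      (f := fun n => listCost G (ρs n) j 0 (ls n)) (by
    filter_upwards [hmin, hρs, (tendsto_listCost hG hρs hρ hlim l₀ le_rfl hl₀).eventually_lt_const
      (lt_add_one _)] with n h1 h2 h3
    exact ⟨listCost_ge hG h2 hB _ h0 h1.1, (h1.2 l₀ hl₀).trans h3.le⟩)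
  obtain ⟨l, hl, hlx, hlR⟩ := exists_limit_control hG hT hm U hρs hρ hlim _ j rfl (fun _ => 0) 0 x
    ls tendsto_const_nhds (Eventually.of_forall fun _ => h0) (hmin.mono fun n hn => hn.1) hx
  refine ⟨l, (isOptimalPath_iff hG hρ l h0).2 ⟨hl, fun l'' hl'' => hlx.trans ?_⟩,
    hlR l' (hls.mono fun n hn => hn.2)⟩
  exact le_of_tendsto_of_tendsto hx (tendsto_listCost hG hρs hρ hlim l'' le_rfl hl'')
    (hmin.mono fun n hn => hn.2 l'' hl'')

end SwitchingMFG

/-! ### Splitting coefficients as conditional probabilities. -/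

namespace SwitchingMFG

open Finset

section PrefixMass

variable {A : Type}

open Classical in
/-- The mass of the paths in `S` that extend `h`. -/
noncomputable def prefixMass (S : Finset (List A)) (q : List A → ℝ) (h : List A) : ℝ :=
  ∑ l ∈ S, if h <+: l then q l else 0

variable {S : Finset (List A)} {q : List A → ℝ}

lemma prefixMass_nonneg (hq : ∀ l, 0 ≤ q l) (h : List A) : 0 ≤ prefixMass S q h :=
  sum_nonneg fun l _ => by
    split_ifs
    · exact hq l
    · exact le_rfl

lemma prefixMass_eq_zero {h : List A} (hh : ¬ ∃ l ∈ S, h <+: l) : prefixMass S q h = 0 :=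
  sum_eq_zero fun l hl => if_neg fun hhl => hh ⟨l, hl, hhl⟩

lemma prefixMass_nil : prefixMass S q [] = ∑ l ∈ S, q l := by
  simp [prefixMass]

variable [Fintype A]

/-- The paths that extend `h` end at `h`, or make one further step. -/
lemma prefixMass_eq (hqS : ∀ l, l ∉ S → q l = 0) (h : List A) :
    prefixMass S q h = q h + ∑ a, prefixMass S q (h ++ [a]) := by
  classical
  have key : ∀ l, (if h <+: l then q l else 0) =
      (if l = h then q l else 0) + ∑ a, if h ++ [a] <+: l then q l else 0 := by
    intro l
    by_cases hl : h <+: l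
    · obtain ⟨t, rfl⟩ := hl
      rcases t with _ | ⟨b, t⟩
      · have : ∀ a : A, ¬ h ++ [a] <+: h := fun a ha => by
          have := ha.length_le
          simp at this
        simp [this]
      · have : ∀ a : A, h ++ [a] <+: h ++ b :: t ↔ a = b := fun a => by
          rw [List.prefix_append_right_inj, List.cons_prefix_cons]
          simp
        simp [this]
    · have h1 : l ≠ h := by
        rintro rfl
        exact hl List.prefix_rfl
      have h2 : ∀ a : A, ¬ h ++ [a] <+: l := fun a ha => hl ((List.prefix_append h [a]).trans ha)
      simp [hl, h1, h2]
  unfold prefixMass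
  rw [sum_congr rfl fun l _ => key l, sum_add_distrib, sum_comm]
  congr 1
  rw [sum_ite_eq']
  split_ifs with hh
  · rfl
  · exact (hqS h hh).symm

/-- Every probability on a finite set of paths comes from splitting coefficients. -/
theorem exists_splitting (hq : ∀ l, 0 ≤ q l) (hqS : ∀ l, l ∉ S → q l = 0)
    (hsum : ∑ l ∈ S, q l = 1) :
    ∃ lam : List A → Option A → ℝ,
      (∀ h a, lam h a ∈ Set.Icc (0 : ℝ) 1) ∧ (∀ h, h ∉ S → lam h none = 0) ∧
      (∀ h a, (¬ ∃ l ∈ S, (h ++ [a]) <+: l) → lam h (some a) = 0) ∧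
      (∀ h, (∃ l ∈ S, h <+: l) → ∑ a, lam h a = 1) ∧
      ∀ l, pathWeight lam [] l = q l := by
  classical
  have hchoice : ∀ h, (∃ l ∈ S, h <+: l) → ∃ o : Option A,
      (o = none → h ∈ S) ∧ ∀ a, o = some a → ∃ l ∈ S, (h ++ [a]) <+: l := by
    rintro h ⟨l, hl, t, rfl⟩
    rcases t with _ | ⟨b, t⟩
    · exact ⟨none, fun _ => by simpa using hl, by simp⟩
    · refine ⟨some b, by simp, fun a ha => ⟨_, hl, t, ?_⟩⟩
      cases ha
      simp
  choose! o ho₁ ho₂ using hchoice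
  let μ := prefixMass S q
  have hμ : ∀ h, 0 ≤ μ h := prefixMass_nonneg hq
  -- The conditional probability of the next choice. Histories of mass zero also need coefficients
  -- of sum 1: there the admissible choice `o h` takes all the weight.
  let lam : List A → Option A → ℝ := fun h x =>
    if 0 < μ h then (x.elim (q h) fun a => μ (h ++ [a])) / μ h
    else if (∃ l ∈ S, h <+: l) ∧ x = o h then 1 else 0
  have hone : ∀ h, (∃ l ∈ S, h <+: l) → ∑ a, lam h a = 1 := by
    intro h hh
    by_cases hpos : 0 < μ h
    · simp only [lam, if_pos hpos]
      rw [← sum_div, Fintype.sum_option, div_eq_one_iff_eq hpos.ne']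
      exact (prefixMass_eq hqS h).symm
    · simp [lam, if_neg hpos, hh]
  have hnonneg : ∀ h a, 0 ≤ lam h a := by
    intro h a
    simp only [lam]
    split_ifs
    · refine div_nonneg ?_ (hμ h)
      cases a
      · exact hq h
      · exact hμ _
    · exact zero_le_one
    · exact le_rfl
  have hzero : ∀ h, (¬ ∃ l ∈ S, h <+: l) → ∀ a, lam h a = 0 := by
    intro h hh a
    have h1 : ¬ 0 < μ h := by simp [μ, prefixMass_eq_zero hh]
    simp only [lam, if_neg h1, hh, false_and, if_false]
  -- The quotients telescope along `l`; at the empty history the mass is 1.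
  have hweight : ∀ l h, μ h * pathWeight lam h l = q (h ++ l) := by
    intro l
    induction l with
    | nil =>
      intro h
      rw [List.append_nil]
      by_cases hpos : 0 < μ h
      · simp only [pathWeight, lam, if_pos hpos, Option.elim]
        field_simp
      · have h0 : μ h = 0 := le_antisymm (not_lt.1 hpos) (hμ h)
        have h1 : μ h = q h + ∑ a, μ (h ++ [a]) := prefixMass_eq hqS h
        have h2 : 0 ≤ ∑ a, μ (h ++ [a]) := sum_nonneg fun a _ => hμ _
        rw [h0, zero_mul]
        linarith [hq h]
    | cons a l ih =>
      intro h
      have hstep : μ h * lam h (some a) = μ (h ++ [a]) := by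
        by_cases hpos : 0 < μ h
        · simp only [lam, if_pos hpos, Option.elim]
          field_simp
        · have h0 : μ h = 0 := le_antisymm (not_lt.1 hpos) (hμ h)
          have h1 : μ h = q h + ∑ a, μ (h ++ [a]) := prefixMass_eq hqS h
          have h2 := single_le_sum (f := fun a => μ (h ++ [a])) (fun a _ => hμ _) (mem_univ a)
          rw [h0, zero_mul]
          linarith [hq h, hμ (h ++ [a])]
      rw [pathWeight, ← mul_assoc, hstep, ih, List.append_assoc, List.singleton_append]
  refine ⟨lam, fun h a => ⟨hnonneg h a, ?_⟩, fun h hh => ?_, fun h a hh => ?_, hone, fun l => ?_⟩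
  · by_cases hh : ∃ l ∈ S, h <+: l
    · rw [← hone h hh]
      exact single_le_sum (fun a _ => hnonneg h a) (mem_univ a)
    · rw [hzero h hh]
      exact zero_le_one
  · by_cases hpos : 0 < μ h
    · simp [lam, if_pos hpos, hqS h hh]
    · simp only [lam, if_neg hpos]
      exact if_neg fun h' => hh (ho₁ h h'.1 h'.2.symm)
  · by_cases hpos : 0 < μ h
    · simp [lam, if_pos hpos, μ, prefixMass_eq_zero hh]
    · simp only [lam, if_neg hpos]
      exact if_neg fun h' => hh (ho₂ h h'.1 a h'.2.symm)
  · have := hweight l []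
    rwa [show μ [] = 1 from prefixMass_nil.trans hsum, one_mul, List.nil_append] at this

end PrefixMass

end SwitchingMFG

/-! ### Mixtures of profiles and the fixed point. -/

namespace SwitchingMFG

open Finset

variable {N : ℕ} {T : ℝ} {G : Costs N T} {m : ℕ}

lemma measurable_location (T : ℝ) (m : ℕ) : ∀ (l : List (Node N × Fin (m + 1))) (p : Node N),
    Measurable (location T m p l)
  | [], _ => measurable_const
  | a :: l, _ => Measurable.ite measurableSet_Iio measurable_const (measurable_location T m l a.1)

lemma measurable_extremalEvolution (T : ℝ) (m : ℕ) (μ : ℝ) (j : Node N)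
    (l : List (Node N × Fin (m + 1))) (k : Node N) : Measurable (extremalEvolution T m μ j l k) :=
  Measurable.ite (measurable_location T m l j (measurableSet_singleton k)) measurable_const
    measurable_const

/-- Switches occur only at multiples of `T / m`, and an open interval of the partition contains
none. -/
lemma location_eq (hT : 0 < T) (hm : 0 < m) {i : ℕ} {t t' : ℝ}
    (ht : t ∈ Set.Ioo ((i : ℝ) * (T / m)) (((i : ℝ) + 1) * (T / m)))
    (ht' : t' ∈ Set.Ioo ((i : ℝ) * (T / m)) (((i : ℝ) + 1) * (T / m))) :
    ∀ (l : List (Node N × Fin (m + 1))) (p : Node N), location T m p l t = location T m p l t'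
  | [], _ => rfl
  | a :: l, p => by
    have hε : 0 < T / m := by positivity
    have key : ∀ {s : ℝ}, s ∈ Set.Ioo ((i : ℝ) * (T / m)) (((i : ℝ) + 1) * (T / m)) →
        (s < ((a.2 : ℕ) : ℝ) * (T / m) ↔ i < (a.2 : ℕ)) := by
      intro s hs
      constructor
      · intro h
        have := lt_of_mul_lt_mul_right (hs.1.trans h) hε.le
        exact_mod_cast this
      · intro h
        refine hs.2.trans_le (mul_le_mul_of_nonneg_right ?_ hε.le)
        exact_mod_cast h
    simp only [location, key ht, key ht', location_eq hT hm ht ht' l]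

/-- The mass in the node `k` at time `t` if, for every `j`, all the agents that start in `j`
follow the path `P j`. -/
noncomputable def profileEvolution (T : ℝ) (m : ℕ) (ρ₀ : Node N → ℝ)
    (P : Node N → List (Node N × Fin (m + 1))) (k : Node N) (t : ℝ) : ℝ :=
  ∑ j, extremalEvolution T m (ρ₀ j) j (P j) k t

variable {ρ₀ : Node N → ℝ}

lemma profileEvolution_mem_Icc (hρ₀ : ∀ j, 0 ≤ ρ₀ j) (P : Node N → List (Node N × Fin (m + 1)))
    (k : Node N) (t : ℝ) : profileEvolution T m ρ₀ P k t ∈ Set.Icc 0 (∑ j, ρ₀ j) := by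
  have h : ∀ j, extremalEvolution T m (ρ₀ j) j (P j) k t ∈ Set.Icc 0 (ρ₀ j) := fun j => by
    unfold extremalEvolution
    split_ifs
    · exact ⟨hρ₀ j, le_rfl⟩
    · exact ⟨le_rfl, hρ₀ j⟩
  exact ⟨sum_nonneg fun j _ => (h j).1, sum_le_sum fun j _ => (h j).2⟩

lemma memLp_profileEvolution (hρ₀ : ∀ j, 0 ≤ ρ₀ j) (P : Node N → List (Node N × Fin (m + 1)))
    (k : Node N) :
    MemLp (profileEvolution T m ρ₀ P k) 2 (volume.restrict (Set.Icc (0 : ℝ) T)) := by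
  refine MemLp.of_bound (Measurable.aestronglyMeasurable ?_) (∑ j, ρ₀ j)
    (Filter.Eventually.of_forall fun t => ?_)
  · exact measurable_fun_sum _ fun j _ => measurable_extremalEvolution T m _ j _ k
  · have := profileEvolution_mem_Icc (T := T) hρ₀ P k t
    rw [Real.norm_eq_abs, abs_of_nonneg this.1]
    exact this.2

variable {Λ : Type*} [Fintype Λ]

/-- The convex combinations of the evolutions generated by the profiles of paths `P i`. -/
noncomputable def mixture (T : ℝ) (hρ₀ : ∀ j, 0 ≤ ρ₀ j)
    (P : Λ → Node N → List (Node N × Fin (m + 1))) (x : Λ → ℝ) : MassTuple N T :=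
  fun k => ∑ i, x i • (memLp_profileEvolution (T := T) hρ₀ (P i) k).toLp

lemma continuous_mixture (hρ₀ : ∀ j, 0 ≤ ρ₀ j) (P : Λ → Node N → List (Node N × Fin (m + 1))) :
    Continuous (mixture T hρ₀ P) := by
  unfold mixture
  fun_prop

lemma mixture_ae (hρ₀ : ∀ j, 0 ≤ ρ₀ j) (P : Λ → Node N → List (Node N × Fin (m + 1)))
    (x : Λ → ℝ) (k : Node N) :
    ∀ᵐ t ∂(volume.restrict (Set.Icc (0 : ℝ) T)),
      mixture T hρ₀ P x k t = ∑ i, x i * profileEvolution T m ρ₀ (P i) k t := by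
  have h : ∀ i, ∀ᵐ t ∂(volume.restrict (Set.Icc (0 : ℝ) T)),
      (x i • (memLp_profileEvolution (T := T) hρ₀ (P i) k).toLp :
        Lp ℝ 2 (volume.restrict (Set.Icc (0 : ℝ) T))) t =
      x i * profileEvolution T m ρ₀ (P i) k t := fun i => by
    filter_upwards [Lp.coeFn_smul (x i) (memLp_profileEvolution (T := T) hρ₀ (P i) k).toLp,
      (memLp_profileEvolution (T := T) hρ₀ (P i) k).coeFn_toLp] with t h1 h2
    rw [h1, Pi.smul_apply, h2, smul_eq_mul]
  filter_upwards [Lp.coeFn_fun_finsetSum univ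
    fun i => x i • (memLp_profileEvolution (T := T) hρ₀ (P i) k).toLp,
    ae_all_iff.2 h] with t h1 h2
  rw [mixture, h1, sum_congr rfl fun i _ => h2 i]

lemma mixture_mem_Ceps (hT : 0 < T) (hm : 0 < m) (hρ₀ : ∀ j, 0 ≤ ρ₀ j)
    (P : Λ → Node N → List (Node N × Fin (m + 1))) {x : Λ → ℝ} (hx : x ∈ stdSimplex ℝ Λ) :
    mixture T hρ₀ P x ∈ Ceps T m ρ₀ := by
  intro k
  refine ⟨fun i _ => ?_, ?_⟩
  · have hε : 0 < T / m := by positivity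
    have hmid : ((i : ℝ) + 1 / 2) * (T / m) ∈
        Set.Ioo ((i : ℝ) * (T / m)) (((i : ℝ) + 1) * (T / m)) := by
      constructor <;> exact mul_lt_mul_of_pos_right (by linarith) hε
    refine ⟨∑ a, x a * profileEvolution T m ρ₀ (P a) k (((i : ℝ) + 1 / 2) * (T / m)), ?_⟩
    filter_upwards [mixture_ae hρ₀ P x k] with t ht hti
    rw [ht]
    simp only [profileEvolution, extremalEvolution, location_eq hT hm hti hmid]
  · filter_upwards [mixture_ae hρ₀ P x k] with t ht
    rw [ht]
    have h := fun i => profileEvolution_mem_Icc (T := T) hρ₀ (P i) k t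
    refine ⟨sum_nonneg fun i _ => mul_nonneg (hx.1 i) (h i).1, ?_⟩
    calc ∑ i, x i * profileEvolution T m ρ₀ (P i) k t ≤ ∑ i, x i * ∑ j, ρ₀ j :=
          sum_le_sum fun i _ => mul_le_mul_of_nonneg_left (h i).2 (hx.1 i)
      _ = ∑ j, ρ₀ j := by rw [← sum_mul, hx.2, one_mul]

lemma Ceps_subset_massSpace (hmass : ∑ j, ρ₀ j ≤ 1) : Ceps T m ρ₀ ⊆ massSpace N T :=
  fun _ hρ k => (hρ k).2.mono fun _ ht => ⟨ht.1, ht.2.trans hmass⟩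

/-- A mixture of profiles of `ε`-optimal paths belongs to the image of `ψ_ε`. -/
theorem mixture_mem_psi (hT : 0 < T) (hm : 0 < m) (hρ₀ : ∀ j, 0 ≤ ρ₀ j)
    (P : Λ → Node N → List (Node N × Fin (m + 1))) {x : Λ → ℝ} (hx : x ∈ stdSimplex ℝ Λ)
    {ρ : MassTuple N T} (hopt : ∀ i, 0 < x i → ∀ j, P i j ∈ epsPaths G m ρ j) :
    mixture T hρ₀ P x ∈ psi G m ρ₀ ρ := by
  classical
  refine ⟨mixture_mem_Ceps hT hm hρ₀ P hx, ?_⟩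
  let S : Node N → Finset (List (Node N × Fin (m + 1))) :=
    fun j => (epsPaths_finite G m ρ j).toFinset
  have hS : ∀ j l, l ∈ S j ↔ l ∈ epsPaths G m ρ j := by simp [S]
  -- The law of the path from `j` is a marginal of `x`. Correlations between starting nodes do not
  -- matter, as the evolution is a sum over `j`.
  let q : Node N → List (Node N × Fin (m + 1)) → ℝ := fun j l => ∑ i, if P i j = l then x i else 0
  have hterm : ∀ i j l, l ∉ S j → (if P i j = l then x i else 0) = 0 := by
    intro i j l hl
    split_ifs with h
    · subst h
      refine le_antisymm (not_lt.1 fun hpos => hl ?_) (hx.1 i)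
      exact (hS j _).2 (hopt i hpos j)
    · rfl
  have hsum : ∀ j (f : List (Node N × Fin (m + 1)) → ℝ),
      ∑ l ∈ S j, q j l * f l = ∑ i, x i * f (P i j) := by
    intro j f
    simp only [q, sum_mul]
    rw [sum_comm]
    refine sum_congr rfl fun i _ => ?_
    rw [sum_eq_single (P i j)]
    · rw [if_pos rfl]
    · intro l _ hl
      rw [if_neg hl.symm, zero_mul]
    · intro hl
      rw [hterm i j _ hl, zero_mul]
  have hsplit := fun j => exists_splitting (S := S j) (q := q j)
    (fun l => sum_nonneg fun i _ => by
      split_ifs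
      · exact hx.1 i
      · exact le_rfl)
    (fun l hl => sum_eq_zero fun i _ => hterm i j l hl)
    (by simpa [hx.2] using hsum j fun _ => 1)
  choose lam h1 h2 h3 h4 h5 using hsplit
  simp only [hS] at h2 h3 h4
  refine ⟨lam, fun j => ⟨h1 j, h2 j, h3 j, h4 j⟩, fun k => ?_⟩
  filter_upwards [mixture_ae hρ₀ P x k] with t ht
  rw [ht]
  simp only [h5]
  rw [sum_congr rfl fun j _ => hsum j fun l => extremalEvolution T m (ρ₀ j) j l k t, sum_comm]
  simp only [profileEvolution, mul_sum]

/-- The set of the weights for which all the paths of a profile are `ε`-optimal is closed. -/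
lemma isClosed_optimal_weights (hG : StandingHypotheses G) (hT : 0 < T) (hm : 0 < m)
    (hρ₀ : ∀ j, 0 ≤ ρ₀ j) (hmass : ∑ j, ρ₀ j ≤ 1) (P : Λ → Node N → List (Node N × Fin (m + 1)))
    (Q : Node N → List (Node N × Fin (m + 1))) :
    IsClosed {x | x ∈ stdSimplex ℝ Λ ∧ ∀ j, Q j ∈ epsPaths G m (mixture T hρ₀ P x) j} := by
  have hmem : ∀ x ∈ stdSimplex ℝ Λ, mixture T hρ₀ P x ∈ massSpace N T := fun x hx =>
    Ceps_subset_massSpace hmass (mixture_mem_Ceps hT hm hρ₀ P hx)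
  rw [isClosed_iff_ultrafilter]
  intro x U hU hUs
  have hx : x ∈ stdSimplex ℝ Λ := isClosed_iff_ultrafilter.1 (isClosed_stdSimplex ℝ Λ) x U hU
    (Filter.mem_of_superset hUs fun y hy => hy.1)
  refine ⟨hx, fun j => ?_⟩
  refine mem_epsPaths_of_tendsto hG hT hm U (ρs := mixture T hρ₀ P) ?_ (hmem x hx)
    (((continuous_mixture hρ₀ P).tendsto x).mono_left hU) ?_
  · exact Filter.mem_of_superset hUs fun y hy => hmem y hy.1
  · exact Filter.mem_of_superset hUs fun y hy => hy.2 j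

lemma length_le_of_mem_epsPaths {ρ : MassTuple N T} {j : Node N}
    {l : List (Node N × Fin (m + 1))} (hl : l ∈ epsPaths G m ρ j) : l.length ≤ N := by
  obtain ⟨l₀, h, h2⟩ := hl
  refine (h2.length_eq.symm.trans_le h.length_le).trans ?_
  exact (card_le_univ _).trans_eq (Fintype.card_fin N)

end SwitchingMFG

theorem theorem5p1 (N : ℕ) (T : ℝ) (hT : 0 < T) (G : SwitchingMFG.Costs N T)
    (hG : SwitchingMFG.StandingHypotheses G)
    (ρ₀ : SwitchingMFG.Node N → ℝ) (hρ₀ : ∀ j, 0 ≤ ρ₀ j) (hmass : ∑ j, ρ₀ j ≤ 1)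
    (m : ℕ) (hm : 0 < m) :
    ∃ ρ : SwitchingMFG.MassTuple N T, SwitchingMFG.IsEpsEquilibrium G m ρ₀ ρ := by
  classical
  -- The bound `N` holds for every distribution, so one finite simplex serves for all of them.
  let Path := {l : List (SwitchingMFG.Node N × Fin (m + 1)) // l.length ≤ N}
  have : Finite Path := (List.finite_length_le (SwitchingMFG.Node N × Fin (m + 1)) N).to_subtype
  have : Nonempty Path := ⟨⟨[], Nat.zero_le _⟩⟩
  have : Fintype (SwitchingMFG.Node N → Path) := Fintype.ofFinite _
  let P : (SwitchingMFG.Node N → Path) → SwitchingMFG.Node N →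
    List (SwitchingMFG.Node N × Fin (m + 1)) := fun i j => (i j).1
  obtain ⟨x, hx, hopt⟩ := Scarf.exists_mem_of_cover
    (fun i => {x | x ∈ stdSimplex ℝ (SwitchingMFG.Node N → Path) ∧
      ∀ j, P i j ∈ SwitchingMFG.epsPaths G m (SwitchingMFG.mixture T hρ₀ P x) j})
    (fun i => SwitchingMFG.isClosed_optimal_weights hG hT hm hρ₀ hmass P (P i)) (by
      intro x hx
      have hρ := SwitchingMFG.Ceps_subset_massSpace hmass
        (SwitchingMFG.mixture_mem_Ceps hT hm hρ₀ P hx)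
      choose l hl using SwitchingMFG.epsPaths_nonempty hG hT hm hρ
      exact ⟨fun j => ⟨l j, SwitchingMFG.length_le_of_mem_epsPaths (hl j)⟩, hx, hl⟩)
  exact ⟨SwitchingMFG.mixture T hρ₀ P x, SwitchingMFG.mixture_mem_Ceps hT hm hρ₀ P hx,
    SwitchingMFG.mixture_mem_psi hT hm hρ₀ P hx fun i hi => (hopt i hi).2⟩
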